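/- A crossed module $(H,G,\mu)$ consists of a group homomorphism $\mu\colon H\to G$ and an action of $G$ on $H$ by automorphisms with $\mu({}^g h)=g\mu(h)g^{-1}$ and ${}^{\mu(h)}h'=hh'h^{-1}$ for all $g\in G$, $h,h'\in H$; a morphism $(H,G,\mu)\to(H',G',\mu')$ is a pair of homomorphisms $H\to H'$, $G\to G'$ compatible with $\mu$, $\mu'$ and the actions. Let $U\colon\mathsf{XMod}\to\mathsf{Set}$ be the forgetful functor $(H,G,\mu)\mapsto H\times G$, and let $F$ be its left adjoint. It sends a set $X$ to the inclusion of the normal closure of the first copy of $F_X$ into the free product $F_X+F_X$, where $F_X$ is the free group on $X$, with the conjugation action. Let $P=(FU,\epsilon,\delta)$ be the comonad induced on $\mathsf{XMod}$, and let $P_*(H,G,\mu)$ be the simplicial crossed module with $P_n=P^{n+1}(H,G,\mu)$, faces $d_i=P^i(\epsilon_{P^{n-i}(H,G,\mu)})$ and degeneracies $s_i=P^i(\delta_{P^{n-i}(H,G,\mu)})$, $0\le i\le n$. For a functor $T\colon\mathsf{XMod}\to\mathsf{Ab}$ put $\mathcal L_nT(H,G,\mu)=\pi_n\bigl(T(P_*(H,G,\mu))\bigr)$,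 the $n$th homology group of the simplicial abelian group $T(P_*(H,G,\mu))$. Let $\mathrm{Ner}_*(H,G,\mu)$ be the simplicial group that is the nerve of the internal category in groups $H\rtimes G\rightrightarrows G$ with source $(h,g)\mapsto g$, target $(h,g)\mapsto\mu(h)g$, identities $g\mapsto(1,g)$ and composition $(h',\mu(h)g)\circ(h,g)=(h'h,g)$. For a group $\Gamma$ let $B_*(\Gamma)$ be the bar resolution of the trivial $\Gamma$-module $\mathbb Z$. The $n$th homology group $H_n(H,G,\mu)$ with integral coefficients is the $n$th homology group of the total complex of the bicomplex with entry $B_q(\mathrm{Ner}_p(H,G,\mu))\otimes_{\mathrm{Ner}_p(H,G,\mu)}\mathbb Z$ in bidegree $(p,q)$, with the bar differential in the direction of $q$ and the alternating sum of the maps induced by the faces of the nerve in the direction of $p$. Let $A\colon\mathsf{XMod}\to\mathsf{Ab}$ be the functor $A(H,G,\mu)=G/(\mu(H)\cdot[G,G])$. **Theorem.** For every crossed module $(H,G,\mu)$ and every $n\ge 0$ there is an isomorphism of abelian groups $$\mathcal L_nA(H,G,\mu)\;\cong\;H_{n+1}(H,G,\mu).$$ -/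

import Mathlib

open CategoryTheory

universe u

noncomputable section

/-! ### The category of crossed modules -/

/-- A crossed module `μ : H → G`; `act g h` is the action `ᵍh`. -/
structure XMod : Type (u + 1) where
  H : Type u
  G : Type u
  [groupH : Group H]
  [groupG : Group G]
  /-- the action of `G` on `H` by group automorphisms -/
  act : G →* MulAut H
  μ : H →* G
  precrossed : ∀ (g : G) (h : H), μ (act g h) = g * μ h * g⁻¹
  peiffer : ∀ h h' : H, act (μ h) h' = h * h' * h⁻¹

namespace XMod

attribute [instance] XMod.groupH XMod.groupG

/-- Morphisms of crossed modules: commutative squares compatible with the actions. -/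
@[ext]
structure Hom (X Y : XMod.{u}) : Type u where
  ρ : X.H →* Y.H
  ν : X.G →* Y.G
  comm : ∀ h, Y.μ (ρ h) = ν (X.μ h)
  equivariant : ∀ g h, ρ (X.act g h) = Y.act (ν g) (ρ h)

instance : Category XMod.{u} where
  Hom := Hom
  id X := ⟨MonoidHom.id _, MonoidHom.id _, fun _ => rfl, fun _ _ => rfl⟩
  comp f g := ⟨g.ρ.comp f.ρ, g.ν.comp f.ν,
    fun h => by simp [f.comm, g.comm], fun a h => by simp [f.equivariant, g.equivariant]⟩

@[ext]
theorem hom_ext {X Y : XMod.{u}} {f g : X ⟶ Y} (h₁ : f.ρ = g.ρ) (h₂ : f.ν = g.ν) : f = g :=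
  Hom.ext h₁ h₂

@[simp] theorem id_ρ (X : XMod.{u}) : Hom.ρ (𝟙 X) = MonoidHom.id _ := rfl
@[simp] theorem id_ν (X : XMod.{u}) : Hom.ν (𝟙 X) = MonoidHom.id _ := rfl
@[simp] theorem comp_ρ {X Y Z : XMod.{u}} (f : X ⟶ Y) (g : Y ⟶ Z) :
    (f ≫ g).ρ = g.ρ.comp f.ρ := rfl
@[simp] theorem comp_ν {X Y Z : XMod.{u}} (f : X ⟶ Y) (g : Y ⟶ Z) :
    (f ≫ g).ν = g.ν.comp f.ν := rfl

/-! ### The free/forgetful adjunction between crossed modules and sets -/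

/-- The forgetful functor, `(H, G, μ) ↦ H × G`. -/
def forgetToType : XMod.{u} ⥤ Type u where
  obj X := X.H × X.G
  map f := TypeCat.ofHom fun p => (f.ρ p.1, f.ν p.2)

/-- The inclusion crossed module of a normal subgroup, with the conjugation action. -/
def inclusion {G : Type u} [Group G] (N : Subgroup G) [N.Normal] : XMod.{u} where
  H := N
  G := G
  act := MulAut.conjNormal
  μ := N.subtype
  precrossed g h := by simp
  peiffer h h' := by ext; simp

/-- The free product `F_X + F_X`. -/
abbrev FreeSum (S : Type u) : Type u := Monoid.Coprod (FreeGroup S) (FreeGroup S)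

/-- The normal closure in `F_X + F_X` of the image of the first injection. -/
abbrev freeKer (S : Type u) : Subgroup (FreeSum S) :=
  Subgroup.normalClosure
    (Set.range (Monoid.Coprod.inl : FreeGroup S →* FreeSum S))

/-- The crossed module freely generated by the set `S`. -/
abbrev free (S : Type u) : XMod.{u} := inclusion (freeKer S)

section Universal

variable {S : Type u} (X : XMod.{u}) (f : S → X.H × X.G)

/-- The homomorphism `F_S + F_S → H ⋊ G` that a map `S → H × G` induces. -/
def freeLiftAux : FreeSum S →* X.H ⋊[X.act] X.G :=
  Monoid.Coprod.lift
    (FreeGroup.lift fun s => SemidirectProduct.inl (f s).1)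
    (FreeGroup.lift fun s => SemidirectProduct.inr (f s).2)

theorem freeLiftAux_right_eq_one {w : FreeSum S} (hw : w ∈ freeKer S) :
    (freeLiftAux X f w).right = 1 := by
  have h : freeKer S ≤ (SemidirectProduct.rightHom.comp (freeLiftAux X f)).ker := by
    refine Subgroup.normalClosure_le_normal ?_
    rintro _ ⟨a, rfl⟩
    have : ((SemidirectProduct.rightHom.comp (freeLiftAux X f)).comp Monoid.Coprod.inl) =
        (1 : FreeGroup S →* X.G) := by
      ext s; simp [freeLiftAux]
    exact DFunLike.congr_fun this a
  exact h hw

end Universal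

/-- The source map `H ⋊ G → G`, `(h, g) ↦ g`. -/
def src (X : XMod.{u}) : X.H ⋊[X.act] X.G →* X.G := SemidirectProduct.rightHom

/-- The target map `H ⋊ G → G`, `(h, g) ↦ μ(h)g`. -/
def tgt (X : XMod.{u}) : X.H ⋊[X.act] X.G →* X.G where
  toFun a := X.μ a.left * a.right
  map_one' := by simp
  map_mul' a b := by simp [X.precrossed, mul_assoc]

/-- The identity map `G → H ⋊ G`, `g ↦ (1, g)`. -/
def ident (X : XMod.{u}) : X.G →* X.H ⋊[X.act] X.G := SemidirectProduct.inr

/-- The composition `(h', g') ∘ (h, g) = (h'h, g)`, meaningful if `μ(h)g = g'`. -/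
def compose (X : XMod.{u}) (a b : X.H ⋊[X.act] X.G) : X.H ⋊[X.act] X.G :=
  ⟨a.left * b.left, b.right⟩

/-- The morphism of crossed modules on `free S` that a map `S → H × G` induces. -/
def freeLift {S : Type u} (X : XMod.{u}) (f : S → X.H × X.G) : free S ⟶ X where
  ρ :=
    { toFun := fun r => (freeLiftAux X f r.1).left
      map_one' := by
        change (freeLiftAux X f 1).left = 1
        simp
      map_mul' := fun a b => by
        change (freeLiftAux X f (a.1 * b.1)).left = _
        simp [freeLiftAux_right_eq_one X f a.2] }
  ν := X.tgt.comp (freeLiftAux X f)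
  comm r := by
    change X.μ (freeLiftAux X f r.1).left =
      X.μ (freeLiftAux X f r.1).left * (freeLiftAux X f r.1).right
    simp [freeLiftAux_right_eq_one X f r.2]
  equivariant g r := by
    have key (w : FreeSum S) : (freeLiftAux X f (w * r.1 * w⁻¹)).left =
        X.act (X.μ (freeLiftAux X f w).left * (freeLiftAux X f w).right)
          (freeLiftAux X f r.1).left := by
      simp [freeLiftAux_right_eq_one X f r.2, X.peiffer]
    exact key g

/-- The generator `s` of the free crossed module, as an element of `H × G`. -/
def freeUnit {S : Type u} (s : S) : (free S).H × (free S).G :=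
  (⟨Monoid.Coprod.inl (FreeGroup.of s), Subgroup.subset_normalClosure ⟨_, rfl⟩⟩,
    Monoid.Coprod.inr (FreeGroup.of s))

theorem free_hom_ext {S : Type u} {X : XMod.{u}} {φ ψ : free S ⟶ X}
    (h : ∀ s : S, (φ.ρ (freeUnit s).1, φ.ν (freeUnit s).2) =
      (ψ.ρ (freeUnit s).1, ψ.ν (freeUnit s).2)) : φ = ψ := by
  have hι (a : FreeGroup S) : (Monoid.Coprod.inl a : FreeSum S) ∈ freeKer S :=
    Subgroup.subset_normalClosure ⟨a, rfl⟩
  let ι : FreeGroup S →* (free S).H :=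
    { toFun := fun a => ⟨Monoid.Coprod.inl a, hι a⟩
      map_one' := Subtype.ext (map_one _)
      map_mul' := fun a b => Subtype.ext (map_mul _ a b) }
  have h1 : φ.ρ.comp ι = ψ.ρ.comp ι := by
    ext s; exact (Prod.ext_iff.1 (h s)).1
  have h2 : φ.ν = ψ.ν := by
    refine Monoid.Coprod.hom_ext ?_ ?_
    · ext s
      have e := congrArg X.μ (Prod.ext_iff.1 (h s)).1
      dsimp only at e
      rw [φ.comm, ψ.comm] at e
      exact e
    · ext s; exact (Prod.ext_iff.1 (h s)).2
  refine hom_ext ?_ h2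
  ext ⟨r, hr⟩
  have key : ∀ r (hr : r ∈ freeKer S), φ.ρ ⟨r, hr⟩ = ψ.ρ ⟨r, hr⟩ := by
    intro r hr
    induction hr using Subgroup.closure_induction with
    | mem x hx =>
      obtain ⟨_, ⟨a, rfl⟩, hc⟩ := Group.mem_conjugatesOfSet_iff.1 hx
      obtain ⟨c, rfl⟩ := isConj_iff.1 hc
      have e : (⟨c * Monoid.Coprod.inl a * c⁻¹, Subgroup.subset_closure hx⟩ : freeKer S) =
          (free S).act c (ι a) := Subtype.ext rfl
      change φ.ρ (⟨c * Monoid.Coprod.inl a * c⁻¹, _⟩ : freeKer S) =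
        ψ.ρ (⟨c * Monoid.Coprod.inl a * c⁻¹, _⟩ : freeKer S)
      rw [e]
      refine (φ.equivariant c (ι a)).trans (Eq.trans ?_ (ψ.equivariant c (ι a)).symm)
      rw [h2]
      exact congrArg _ (DFunLike.congr_fun h1 a)
    | one => exact (map_one φ.ρ).trans (map_one ψ.ρ).symm
    | mul x y hx hy ihx ihy =>
      exact (map_mul φ.ρ (⟨x, hx⟩ : freeKer S) ⟨y, hy⟩).trans
        ((congrArg₂ _ ihx ihy).trans (map_mul ψ.ρ (⟨x, hx⟩ : freeKer S) ⟨y, hy⟩).symm)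
    | inv x hx ih =>
      exact (map_inv φ.ρ (⟨x, hx⟩ : freeKer S)).trans
        ((congrArg _ ih).trans (map_inv ψ.ρ (⟨x, hx⟩ : freeKer S)).symm)
  exact key r hr

/-- Morphisms `free S ⟶ X` correspond to maps from `S` to the underlying set of `X`. -/
def freeEquiv (S : Type u) (X : XMod.{u}) : (free S ⟶ X) ≃ (S ⟶ forgetToType.obj X) where
  toFun φ := TypeCat.ofHom fun s => (φ.ρ (freeUnit s).1, φ.ν (freeUnit s).2)
  invFun f := freeLift X fun s => f s
  left_inv φ := free_hom_ext fun s => by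
    refine Prod.ext ?_ ?_
    · change (freeLiftAux X _ (Monoid.Coprod.inl (FreeGroup.of s))).left = _
      simp [freeLiftAux]; rfl
    · change X.tgt (freeLiftAux X _ (Monoid.Coprod.inr (FreeGroup.of s))) = _
      simp [freeLiftAux, tgt]; rfl
  right_inv f := by
    ext s
    refine Prod.ext ?_ ?_
    · change (freeLiftAux X _ (Monoid.Coprod.inl (FreeGroup.of s))).left = _
      simp [freeLiftAux]
    · change X.tgt (freeLiftAux X _ (Monoid.Coprod.inr (FreeGroup.of s))) = _
      simp [freeLiftAux, tgt]

/-- The free crossed module functor, left adjoint to the forgetful functor. -/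
def freeFunctor : Type u ⥤ XMod.{u} :=
  Adjunction.leftAdjointOfEquiv (G := forgetToType) freeEquiv fun _ _ _ _ _ => rfl

/-- The free/forgetful adjunction. -/
def freeForgetAdjunction : freeFunctor.{u} ⊣ forgetToType.{u} :=
  Adjunction.adjunctionOfEquivLeft freeEquiv fun _ _ _ _ _ => rfl

/-- The comonad `P = (FU, ε, F η U)` on the category of crossed modules. -/
def freeComonad : Comonad XMod.{u} := freeForgetAdjunction.toComonad

end XMod

/-! ### The nerve, and homology with integral coefficients -/

namespace XMod

theorem compose_mul (X : XMod.{u}) {a b a' b' : X.H ⋊[X.act] X.G}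
    (h : X.src a = X.tgt b) :
    X.compose a b * X.compose a' b' = X.compose (a * a') (b * b') := by
  have h : a.right = X.μ b.left * b.right := h
  ext <;> simp [compose, h, X.peiffer, mul_assoc]

theorem compose_inv (X : XMod.{u}) {a b : X.H ⋊[X.act] X.G} (h : X.src a = X.tgt b) :
    (X.compose a b)⁻¹ = X.compose a⁻¹ b⁻¹ := by
  have h1 : X.compose 1 1 = 1 := by ext <;> simp [compose]
  rw [inv_eq_iff_mul_eq_one, compose_mul X h]
  simp [h1]

/-- The group of diagrams of shape `Jᵒᵖ`, `J` a preordered set, in the internal category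
`H ⋊ G ⇉ G`: a diagram `f` consists of an arrow `f (i, j)` for all `i ≤ j`, from the object
`src (f (j, j))` to the object `src (f (i, i))`, with `f (i, i)` the identity, such that
`f (i, k) = f (i, j) ∘ f (j, k)`. -/
def diagrams (X : XMod.{u}) (J : Type) [Preorder J] :
    Subgroup ({p : J × J // p.1 ≤ p.2} → X.H ⋊[X.act] X.G) where
  carrier := {f |
    (∀ i, f ⟨(i, i), le_rfl⟩ = X.ident (X.src (f ⟨(i, i), le_rfl⟩))) ∧
    (∀ i j (h : i ≤ j), X.src (f ⟨(i, j), h⟩) = X.src (f ⟨(j, j), le_rfl⟩)) ∧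
    (∀ i j (h : i ≤ j), X.tgt (f ⟨(i, j), h⟩) = X.src (f ⟨(i, i), le_rfl⟩)) ∧
    ∀ i j k (h : i ≤ j) (h' : j ≤ k),
      f ⟨(i, k), h.trans h'⟩ = X.compose (f ⟨(i, j), h⟩) (f ⟨(j, k), h'⟩)}
  one_mem' := by
    refine ⟨by simp, by simp, by simp, fun _ _ _ _ _ => ?_⟩
    ext <;> simp [compose]
  mul_mem' {a b} ha hb := by
    refine ⟨fun i => ?_, fun i j h => ?_, fun i j h => ?_, fun i j k h h' => ?_⟩
    · simp only [Pi.mul_apply, map_mul, ← ha.1, ← hb.1]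
    · simp only [Pi.mul_apply, map_mul, ha.2.1 i j h, hb.2.1 i j h]
    · simp only [Pi.mul_apply, map_mul, ha.2.2.1 i j h, hb.2.2.1 i j h]
    · simp only [Pi.mul_apply]
      rw [ha.2.2.2 i j k h h', hb.2.2.2 i j k h h', compose_mul]
      rw [ha.2.1 i j h, ha.2.2.1 j k h']
  inv_mem' {a} ha := by
    refine ⟨fun i => ?_, fun i j h => ?_, fun i j h => ?_, fun i j k h h' => ?_⟩
    · simp only [Pi.inv_apply, map_inv, ← ha.1]
    · simp only [Pi.inv_apply, map_inv, ha.2.1 i j h]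
    · simp only [Pi.inv_apply, map_inv, ha.2.2.1 i j h]
    · simp only [Pi.inv_apply]
      rw [ha.2.2.2 i j k h h', compose_inv]
      rw [ha.2.1 i j h, ha.2.2.1 j k h']

/-- Restriction of diagrams along a monotone map. -/
def restrict (X : XMod.{u}) {J K : Type} [Preorder J] [Preorder K] (α : J →o K) :
    X.diagrams K →* X.diagrams J where
  toFun f := ⟨fun p => f.1 ⟨(α p.1.1, α p.1.2), α.monotone p.2⟩,
    fun _ => f.2.1 _, fun _ _ _ => f.2.2.1 _ _ _, fun _ _ _ => f.2.2.2.1 _ _ _,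
    fun _ _ _ _ _ => f.2.2.2.2 _ _ _ _ _⟩
  map_one' := rfl
  map_mul' _ _ := rfl

/-- The homomorphism `H ⋊ G → H' ⋊ G'` that a morphism of crossed modules induces. -/
def Hom.semidirect {X Y : XMod.{u}} (φ : X ⟶ Y) : X.H ⋊[X.act] X.G →* Y.H ⋊[Y.act] Y.G :=
  SemidirectProduct.map φ.ρ φ.ν fun g => by ext h; simp [φ.equivariant]

/-- The homomorphism between groups of diagrams that a morphism of crossed modules induces. -/
def mapDiagrams {X Y : XMod.{u}} (φ : X ⟶ Y) (J : Type) [Preorder J] :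
    X.diagrams J →* Y.diagrams J where
  toFun f := ⟨fun p => Hom.semidirect φ (f.1 p), by
    have hs (a : X.H ⋊[X.act] X.G) : Y.src (Hom.semidirect φ a) = φ.ν (X.src a) := rfl
    have ht (a : X.H ⋊[X.act] X.G) : Y.tgt (Hom.semidirect φ a) = φ.ν (X.tgt a) := by
      change Y.μ (φ.ρ a.left) * φ.ν a.right = φ.ν (X.μ a.left * a.right)
      rw [φ.comm, map_mul]
    refine ⟨fun i => ?_, fun i j h => ?_, fun i j h => ?_, fun i j k h h' => ?_⟩
    · change Hom.semidirect φ (f.1 ⟨(i, i), le_rfl⟩) =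
        Y.ident (Y.src (Hom.semidirect φ (f.1 ⟨(i, i), le_rfl⟩)))
      rw [hs, f.2.1 i]
      ext
      · exact map_one φ.ρ
      · rfl
    · rw [hs, hs, f.2.2.1 i j h]
    · rw [ht, hs, f.2.2.2.1 i j h]
    · change Hom.semidirect φ (f.1 ⟨(i, k), h.trans h'⟩) = _
      rw [f.2.2.2.2 i j k h h']
      ext
      · exact map_mul φ.ρ _ _
      · rfl⟩
  map_one' := Subtype.ext (funext fun _ => map_one _)
  map_mul' _ _ := Subtype.ext (funext fun _ => map_mul _ _ _)

/-- The nerve of a crossed module, a simplicial group. An `n`-simplex is a chain of composable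
arrows `x₀ ← x₁ ← ⋯ ← xₙ` of the internal category `H ⋊ G ⇉ G`, with its composites. It amounts
to `(h₁, …, hₙ, g) ∈ H ⋊ (⋯ (H ⋊ G))`, where `g = xₙ` and `hᵢ` is the `H`-component of the arrow
`xᵢ → xᵢ₋₁`; the face `dᵢ` omits `xᵢ`, the degeneracy `sᵢ` repeats `xᵢ`. -/
def nerve : XMod.{u} ⥤ SimplicialObject GrpCat.{u} where
  obj X :=
    { obj := fun Δ => GrpCat.of (X.diagrams (Fin (Δ.unop.len + 1)))
      map := fun α => GrpCat.ofHom (X.restrict α.unop.toOrderHom)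
      map_id := fun _ => rfl
      map_comp := fun _ _ => rfl }
  map φ :=
    { app := fun Δ => GrpCat.ofHom (mapDiagrams φ (Fin (Δ.unop.len + 1)))
      naturality := fun _ _ _ => rfl }
  map_id _ := rfl
  map_comp _ _ := rfl

/-- The integers, as a ring in an arbitrary universe. -/
abbrev Int' : Type u := ULift.{u} ℤ

/-- The functor `G ↦ B_*(G) ⊗_G ℤ`, `ℤ` the trivial `G`-module and `B_*(G)` the bar resolution:
in degree `m` it has the free abelian group on `Gᵐ`. -/
def integralChains : GrpCat.{u} ⥤ ChainComplex (ModuleCat.{u} Int'.{u}) ℕ where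
  obj G := groupHomology.inhomogeneousChains (Rep.trivial Int'.{u} G Int'.{u})
  map {G K} f := groupHomology.chainsMap f.hom
    (𝟙 (Rep.trivial Int'.{u} G Int'.{u}) :
      Rep.trivial Int'.{u} G Int'.{u} ⟶ Rep.res f.hom (Rep.trivial Int'.{u} K Int'.{u}))
  map_id _ := groupHomology.chainsMap_id
  map_comp {G K L} f g := groupHomology.chainsMap_comp f.hom g.hom
    (A := Rep.trivial Int'.{u} G Int'.{u}) (B := Rep.trivial Int'.{u} K Int'.{u})
    (C := Rep.trivial Int'.{u} L Int'.{u}) (𝟙 _) (𝟙 _)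

/-- The bicomplex `B(Nerve_*(H, G, μ), ℤ)` with entry `B_q(Nerve_p) ⊗_{Nerve_p} ℤ` in bidegree
`(p, q)`; in the direction of `p` the differential is the alternating sum of the faces. -/
def bicomplex : XMod.{u} ⥤
    HomologicalComplex₂ (ModuleCat.{u} Int'.{u}) (ComplexShape.down ℕ) (ComplexShape.down ℕ) :=
  nerve ⋙ (SimplicialObject.whiskering _ _).obj integralChains ⋙
    AlgebraicTopology.alternatingFaceMapComplex (ChainComplex (ModuleCat.{u} Int'.{u}) ℕ)

/-- The `n`-th homology group `Hₙ(H, G, μ)` with integral coefficients, the homology of the total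
complex of the bicomplex. -/
def homology (n : ℕ) : XMod.{u} ⥤ AddCommGrpCat.{u} :=
  bicomplex ⋙ HomologicalComplex₂.totalFunctor (ModuleCat.{u} Int'.{u})
      (ComplexShape.down ℕ) (ComplexShape.down ℕ) (ComplexShape.down ℕ) ⋙
    HomologicalComplex.homologyFunctor (ModuleCat.{u} Int'.{u}) (ComplexShape.down ℕ) n ⋙
    forget₂ (ModuleCat.{u} Int'.{u}) AddCommGrpCat.{u}

/-! ### The coefficient functor -/

instance (X : XMod.{u}) : X.μ.range.Normal where
  conj_mem := by
    rintro _ ⟨h, rfl⟩ g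
    exact ⟨X.act g h, X.precrossed g h⟩

/-- The normal subgroup `μ(H)[G, G]` of `G`. -/
abbrev coeffKer (X : XMod.{u}) : Subgroup X.G := X.μ.range ⊔ commutator X.G

open scoped commutatorElement in
instance (X : XMod.{u}) : CommGroup (X.G ⧸ X.coeffKer) where
  mul_comm := by
    rintro ⟨a⟩ ⟨b⟩
    refine QuotientGroup.eq.2 (Subgroup.mem_sup_right ?_)
    have : (a * b)⁻¹ * (b * a) = ⁅b⁻¹, a⁻¹⁆ := by simp [commutatorElement_def, mul_assoc]
    rw [this]
    exact Subgroup.commutator_mem_commutator (Subgroup.mem_top _) (Subgroup.mem_top _)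

/-- The functor `A`, `(H, G, μ) ↦ G / (μ(H)[G, G])`. -/
def coeff : XMod.{u} ⥤ AddCommGrpCat.{u} where
  obj X := AddCommGrpCat.of (Additive (X.G ⧸ X.coeffKer))
  map {X Y} φ := AddCommGrpCat.ofHom (MonoidHom.toAdditive
    (QuotientGroup.map X.coeffKer Y.coeffKer φ.ν (by
      refine sup_le ?_ ?_
      · rintro _ ⟨h, rfl⟩
        exact Subgroup.mem_sup_left ⟨φ.ρ h, φ.comm h⟩
      · rw [← Subgroup.map_le_iff_le_comap, commutator_def, Subgroup.map_commutator]
        exact le_sup_of_le_right (Subgroup.commutator_mono le_top le_top))))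
  map_id _ := by
    refine AddCommGrpCat.hom_ext (AddMonoidHom.ext fun x => ?_)
    obtain ⟨y, rfl⟩ := QuotientGroup.mk_surjective x
    rfl
  map_comp _ _ := by
    refine AddCommGrpCat.hom_ext (AddMonoidHom.ext fun x => ?_)
    obtain ⟨y, rfl⟩ := QuotientGroup.mk_surjective x
    rfl

end XMod

/-! ### The cotriple resolution and comonadic left derived functors -/

namespace Cotriple

universe v w

variable {C : Type w} [Category.{v} C] (P : Comonad C)

/-- The iterated endofunctor `Pⁿ`. -/
def power : ℕ → C ⥤ C
  | 0 => 𝟭 C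
  | n + 1 => power n ⋙ P.toFunctor

/-- The transformation `P^{n+1} ⟶ Pⁿ` given by `ε_{Pⁿ X}`. -/
def eps (n : ℕ) : power P (n + 1) ⟶ power P n where
  app X := P.ε.app ((power P n).obj X)
  naturality _ _ f := P.ε.naturality ((power P n).map f)

/-- The transformation `P^{n+1} ⟶ P^{n+2}` given by `δ_{Pⁿ X}`. -/
def del (n : ℕ) : power P (n + 1) ⟶ power P (n + 2) where
  app X := P.δ.app ((power P n).obj X)
  naturality _ _ f := P.δ.naturality ((power P n).map f)

variable {P} in
/-- The transformation `P^{n+1} ⟶ P^{m+1}` given by `P(f_X)`. -/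
def lift {n m : ℕ} (f : power P n ⟶ power P m) : power P (n + 1) ⟶ power P (m + 1) :=
  Functor.whiskerRight f P.toFunctor

theorem lift_id (n : ℕ) : lift (𝟙 (power P n)) = 𝟙 (power P (n + 1)) :=
  NatTrans.ext (funext fun X => P.map_id ((power P n).obj X))

section

variable {P} {a b c : ℕ} (f : power P a ⟶ power P b)

theorem lift_comp (g : power P b ⟶ power P c) : lift (f ≫ g) = lift f ≫ lift g :=
  Functor.whiskerRight_comp f g P.toFunctor

theorem lift_eps : lift f ≫ eps P b = eps P a ≫ f :=
  NatTrans.ext (funext fun X => P.ε.naturality (f.app X))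

theorem lift_del : lift f ≫ del P b = del P a ≫ lift (lift f) :=
  NatTrans.ext (funext fun X => P.δ.naturality (f.app X))

end

theorem del_eps (n : ℕ) : del P n ≫ eps P (n + 1) = 𝟙 _ :=
  NatTrans.ext (funext fun X => P.left_counit ((power P n).obj X))

theorem del_lift_eps (n : ℕ) : del P n ≫ lift (eps P n) = 𝟙 _ :=
  NatTrans.ext (funext fun X => P.right_counit ((power P n).obj X))

theorem del_del (n : ℕ) : del P n ≫ del P (n + 1) = del P n ≫ lift (del P n) :=
  NatTrans.ext (funext fun X => (P.coassoc ((power P n).obj X)).symm)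

/-- For a map `α` with `α 0 = 0`: forget the first point of its domain. -/
def dropFirst {m n : ℕ} (α : Fin (m + 1) →o Fin n) : Fin m →o Fin n where
  toFun i := α i.succ
  monotone' _ _ h := α.monotone (Fin.succ_le_succ_iff.2 h)

/-- For a map `α` that avoids `0`: forget the first point of its codomain. -/
def dropZero {m n : ℕ} (α : Fin m →o Fin (n + 1)) (hα : ∀ i, α i ≠ 0) : Fin m →o Fin n where
  toFun i := (α i).pred (hα i)
  monotone' _ _ h := Fin.pred_le_pred_iff.2 (α.monotone h)

theorem ne_zero_of_monotone {m n : ℕ} (α : Fin (m + 1) →o Fin (n + 1)) (h : α 0 ≠ 0)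
    (i : Fin (m + 1)) : α i ≠ 0 := fun hi =>
  h (le_antisymm (hi ▸ α.monotone (Fin.zero_le i)) (Fin.zero_le _))

/-- The transformation `Pⁿ ⟶ Pᵐ` that a monotone map `α : {0,…,m-1} → {0,…,n-1}` induces: the
`j`-th factor `P` of `Pⁿ` (counted from the outside) is sent by the iterated comultiplication to
as many factors as the fibre of `α` over `j` has points, by the counit if the fibre is empty. -/
def powerMap : {n m : ℕ} → (Fin m →o Fin n) → (power P n ⟶ power P m)
  | 0, 0, _ => 𝟙 _
  | 0, _ + 1, α => (α 0).elim0
  | n + 1, 0, α => eps P n ≫ powerMap (dropZero α fun i => i.elim0)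
  | n + 1, m + 1, α =>
    if h : α 0 = 0 then
      del P n ≫ lift (powerMap (dropFirst α))
    else
      eps P n ≫ powerMap (dropZero α (ne_zero_of_monotone α h))
  termination_by n m => n + m

variable {P} in
theorem powerMap_bar {n m : ℕ} (α : Fin m →o Fin (n + 1)) (h : ∀ i, α i ≠ 0) :
    powerMap P α = eps P n ≫ powerMap P (dropZero α h) := by
  cases m with
  | zero => rw [powerMap]
  | succ m => rw [powerMap, dif_neg (h 0)]

variable {P} in
theorem powerMap_dot {n m : ℕ} (α : Fin (m + 1) →o Fin (n + 1)) (h : α 0 = 0) :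
    powerMap P α = del P n ≫ lift (powerMap P (dropFirst α)) := by
  rw [powerMap, dif_pos h]

theorem powerMap_id (n : ℕ) : powerMap P (OrderHom.id : Fin n →o Fin n) = 𝟙 _ := by
  induction n with
  | zero => rw [powerMap]
  | succ n ih =>
    have h : ∀ i, dropFirst (OrderHom.id : Fin (n + 1) →o Fin (n + 1)) i ≠ 0 :=
      fun i => Fin.succ_ne_zero i
    have e : dropZero (dropFirst (OrderHom.id : Fin (n + 1) →o Fin (n + 1))) h = OrderHom.id := by
      ext i; rfl
    rw [powerMap_dot _ rfl, powerMap_bar _ h, e, ih, Category.comp_id, del_lift_eps]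

theorem powerMap_comp {k n m : ℕ} (β : Fin n →o Fin k) (α : Fin m →o Fin n) :
    powerMap P (β.comp α) = powerMap P β ≫ powerMap P α := by
  match k, n, m, β, α with
  | 0, 0, 0, β, α =>
    have hα : powerMap P α = 𝟙 _ := by rw [powerMap]
    rw [hα, Category.comp_id]
    exact congrArg _ (by ext i; exact i.elim0)
  | 0, _ + 1, _, β, _ => exact (β 0).elim0
  | _, 0, _ + 1, _, α => exact (α 0).elim0
  | k + 1, n, m, β, α =>
    by_cases h : ∀ i, β i ≠ 0
    · have e := powerMap_comp (dropZero β h) α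
      rw [powerMap_bar β h, powerMap_bar (P := P) (β.comp α) (fun i => h (α i)),
        Category.assoc, ← e]
      rfl
    · cases n with
      | zero => exact absurd (fun i => i.elim0) h
      | succ n =>
        have hβ : β 0 = 0 := by
          by_contra h0
          exact h (ne_zero_of_monotone β h0)
        by_cases h' : ∀ i, α i ≠ 0
        · have e : β.comp α = (dropFirst β).comp (dropZero α h') := by
            ext i
            change (β (α i)).1 = (β ((α i).pred (h' i)).succ).1
            rw [Fin.succ_pred]
          rw [e, powerMap_comp (dropFirst β) (dropZero α h'), powerMap_dot β hβ,
            powerMap_bar α h', Category.assoc, ← Category.assoc (lift _), lift_eps,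
            Category.assoc, ← Category.assoc, del_eps, Category.id_comp]
        · cases m with
          | zero => exact absurd (fun i => i.elim0) h'
          | succ m =>
            have hα : α 0 = 0 := by
              by_contra h0
              exact h' (ne_zero_of_monotone α h0)
            have hβα : (β.comp α) 0 = 0 := by
              change β (α 0) = 0
              rw [hα, hβ]
            have e : dropFirst (β.comp α) = β.comp (dropFirst α) := by
              ext i; rfl
            rw [powerMap_dot (β.comp α) hβα, e, powerMap_comp β (dropFirst α),
              powerMap_dot α hα, powerMap_dot β hβ, lift_comp, lift_comp, Category.assoc (del P k),
              ← Category.assoc (lift _) (del P n), lift_del, Category.assoc,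
              Category.assoc (del P (k + 1)), ← Category.assoc (del P k) (del P (k + 1)), del_del,
              Category.assoc]
  termination_by k + n + m

/-- The cotriple resolution `X ↦ P_* X`, with `Pₙ X = Pⁿ⁺¹ X`. Its faces and degeneracies are
`dᵢ = Pⁱ(ε_{Pⁿ⁻ⁱ X})` and `sᵢ = Pⁱ(δ_{Pⁿ⁻ⁱ X})`. -/
def resolution : C ⥤ SimplicialObject C :=
  Functor.flip
    { obj := fun Δ => power P (Δ.unop.len + 1)
      map := fun f => powerMap P f.unop.toOrderHom
      map_id := fun _ => powerMap_id P _
      map_comp := fun f g => powerMap_comp P f.unop.toOrderHom g.unop.toOrderHom }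

/-- The `n`-th left derived functor `ℒₙT = πₙ(T(P_* -))` of `T` with respect to the comonad `P`;
the homotopy of a simplicial abelian group is the homology of its alternating face complex. -/
def leftDerived (T : C ⥤ AddCommGrpCat.{u}) (n : ℕ) : C ⥤ AddCommGrpCat.{u} :=
  resolution P ⋙ (SimplicialObject.whiskering C AddCommGrpCat.{u}).obj T ⋙
    AlgebraicTopology.alternatingFaceMapComplex AddCommGrpCat.{u} ⋙
    HomologicalComplex.homologyFunctor AddCommGrpCat.{u} (ComplexShape.down ℕ) n

theorem resolution_δ_zero (X : C) (n : ℕ) :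
    ((resolution P).obj X).δ (0 : Fin (n + 2)) = P.ε.app ((power P (n + 1)).obj X) := by
  let α : Fin (n + 1) →o Fin (n + 2) := (SimplexCategory.δ (0 : Fin (n + 2))).toOrderHom
  have h : ∀ i, α i ≠ 0 := fun i => Fin.succ_ne_zero i
  have e : dropZero α h = OrderHom.id := by ext i; rfl
  change (powerMap P α).app X = _
  rw [powerMap_bar α h, e, powerMap_id, Category.comp_id]
  rfl

theorem resolution_δ_succ (X : C) (n : ℕ) (i : Fin (n + 2)) :
    ((resolution P).obj X).δ i.succ = P.map (((resolution P).obj X).δ i) := by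
  let α : Fin (n + 2) →o Fin (n + 3) := (SimplexCategory.δ i.succ).toOrderHom
  let α' : Fin (n + 1) →o Fin (n + 2) := (SimplexCategory.δ i).toOrderHom
  have h0 : α 0 = 0 := Fin.succ_succAbove_zero i
  have hs (j : Fin (n + 1)) : dropFirst α j = (α' j).succ := Fin.succ_succAbove_succ i j
  have h : ∀ j, dropFirst α j ≠ 0 := fun j => by rw [hs]; exact Fin.succ_ne_zero _
  have e : dropZero (dropFirst α) h = α' := by
    ext j; simp [dropZero, hs]
  change (powerMap P α).app X = P.map ((powerMap P α').app X)
  rw [powerMap_dot α h0, powerMap_bar _ h, e, lift_comp, ← Category.assoc, del_lift_eps,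
    Category.id_comp]
  rfl

theorem resolution_σ_zero (X : C) (n : ℕ) :
    ((resolution P).obj X).σ (0 : Fin (n + 1)) = P.δ.app ((power P n).obj X) := by
  let α : Fin (n + 2) →o Fin (n + 1) := (SimplexCategory.σ (0 : Fin (n + 1))).toOrderHom
  have h0 : α 0 = 0 := rfl
  have e : dropFirst α = OrderHom.id := by ext i; simp [dropFirst, α, SimplexCategory.σ]
  change (powerMap P α).app X = _
  rw [powerMap_dot α h0, e, powerMap_id, lift_id, Category.comp_id]
  rfl

theorem resolution_σ_succ (X : C) (n : ℕ) (i : Fin (n + 1)) :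
    ((resolution P).obj X).σ i.succ = P.map (((resolution P).obj X).σ i) := by
  let α : Fin (n + 3) →o Fin (n + 2) := (SimplexCategory.σ i.succ).toOrderHom
  let α' : Fin (n + 2) →o Fin (n + 1) := (SimplexCategory.σ i).toOrderHom
  have h0 : α 0 = 0 := by simp [α, SimplexCategory.σ]
  have hs (j : Fin (n + 2)) : dropFirst α j = (α' j).succ := Fin.succ_predAbove_succ i j
  have h : ∀ j, dropFirst α j ≠ 0 := fun j => by rw [hs]; exact Fin.succ_ne_zero _
  have e : dropZero (dropFirst α) h = α' := by
    ext j; simp [dropZero, hs]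
  change (powerMap P α).app X = P.map ((powerMap P α').app X)
  rw [powerMap_dot α h0, powerMap_bar _ h, e, lift_comp, ← Category.assoc, del_lift_eps,
    Category.id_comp]
  rfl

end Cotriple

end

/-! Let `T` be the total complex that defines the homology of a crossed module. Its differential
from degree one to degree zero vanishes (`totalComplex_d_one_zero`), so discarding the term of
degree zero gives a functor `T'` to chain complexes with `Hₙ(T') = Hₙ₊₁(T)`
(`nonempty_homology_truncate_iso`). The theorem is proved by computing with the double complex
`T'(P_* X)` in two ways.

Along the resolution: each term of `T` is a sum of free modules on powers of the sets `Ner_p`, and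
`Ner_p` has coordinates in copies of `H` and one copy of `G`. Sending each coordinate to the
corresponding free generator gives a section of `T_m(PX) → T_m(X)` that is natural in `X`, although
compatible neither with multiplication nor with the differential of `T` (`totalCounitSection`).
Naturality alone makes it an extra degeneracy, so `T'(P_* X)` resolves `T'(X)` in each degree.

Along `T'`: a free crossed module is the inclusion of a normal subgroup of `F_S + F_S` with split
quotient `F_S`. Its nerve consists of tuples congruent modulo that subgroup, and putting the chosen
representative of the class in front contracts it onto the constant simplicial group `F_S`
(`columnContraction`). Thus `Hₙ(T)` vanishes for `n ≥ 2` on free crossed modules, because free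
groups have no homology there (`Fox.exactAt_inhomogeneousChains`), and `T'(Pᵏ⁺¹ X)` has homology in
degree zero only.

Finally `H₀(T') = A` naturally: bar boundaries make the class of `g` additive, arrows of the nerve
identify `g` with `μ(h)g`, and the remaining generators are boundaries (`coeffAugIsCokernel`).
Balancing (`nonempty_homology_iso_of_augmentation`) gives `πₙ(A(P_* X)) ≅ Hₙ(T'(X)) ≅ Hₙ₊₁(X)`. -/

noncomputable section

/-! ### Total complexes of contracted bicomplexes -/

namespace HomologicalComplex₂
variable {C : Type*} [Category* C] [Preadditive C]
  (K : HomologicalComplex₂ C (ComplexShape.down ℕ) (ComplexShape.down ℕ))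
  [K.HasTotal (ComplexShape.down ℕ)]
local notation "cN" => ComplexShape.down ℕ

/-- On the two edges of the quadrant one of the two summands has no target, whence the separate
formulas for `p = 0` and `q = 0` that follow. -/
lemma ι_total_d_succ_succ (p q n m : ℕ) (h : p + 1 + (q + 1) = n) (hm : m + 1 = n) :
    K.ιTotal cN (p + 1) (q + 1) n h ≫ (K.total cN).d n m =
      (K.d (p + 1) p).f (q + 1) ≫ K.ιTotal cN p (q + 1) m (by change p + (q + 1) = m; lia) +
      (-1 : ℤˣ) ^ (p + 1) • ((K.X (p + 1)).d (q + 1) q ≫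
        K.ιTotal cN (p + 1) q m (by change p + 1 + q = m; lia)) := by
  rw [total_d, Preadditive.comp_add, ι_D₁, ι_D₂,
    K.d₁_eq cN (i₁' := p) rfl (q + 1) m (by change p + (q + 1) = m; lia),
    K.d₂_eq cN (p + 1) (i₂' := q) rfl m (by change p + 1 + q = m; lia)]
  congr 1
  exact one_smul _ _

lemma ι_total_d_zero_succ (q n m : ℕ) (h : 0 + (q + 1) = n) (hm : m + 1 = n) :
    K.ιTotal cN 0 (q + 1) n h ≫ (K.total cN).d n m =
      ((K.X 0).d (q + 1) q ≫ K.ιTotal cN 0 q m (by change 0 + q = m; lia)) := by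
  rw [total_d, Preadditive.comp_add, ι_D₁, ι_D₂,
    K.d₁_eq_zero cN 0 (q + 1) m (by simp),
    K.d₂_eq cN 0 (i₂' := q) rfl m (by change 0 + q = m; lia), zero_add]
  exact one_smul _ _

lemma ι_total_d_succ_zero (p n m : ℕ) (h : p + 1 + 0 = n) (hm : m + 1 = n) :
    K.ιTotal cN (p + 1) 0 n h ≫ (K.total cN).d n m =
      (K.d (p + 1) p).f 0 ≫ K.ιTotal cN p 0 m (by change p + 0 = m; lia) := by
  rw [total_d, Preadditive.comp_add, ι_D₁, ι_D₂,
    K.d₁_eq cN (i₁' := p) rfl 0 m (by change p + 0 = m; lia),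
    K.d₂_eq_zero cN (p + 1) 0 m (by simp), add_zero]
  exact one_smul _ _

end HomologicalComplex₂

/-- A bicomplex whose columns (as complexes) are contracted, by maps of complexes, onto a complex
`L` in degree zero. -/
structure HomologicalComplex₂.ColumnContraction {C : Type*} [Category* C] [Preadditive C]
    (K : HomologicalComplex₂ C (ComplexShape.down ℕ) (ComplexShape.down ℕ))
    (L : ChainComplex C ℕ) where
  ε : K.X 0 ⟶ L
  s : L ⟶ K.X 0
  h (p : ℕ) : K.X p ⟶ K.X (p + 1)
  d_ε : K.d 1 0 ≫ ε = 0
  comm_zero : h 0 ≫ K.d 1 0 + ε ≫ s = 𝟙 _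
  comm_succ (p : ℕ) : h (p + 1) ≫ K.d (p + 2) (p + 1) + K.d (p + 1) p ≫ h p = 𝟙 _

open Limits

namespace HomologicalComplex₂.ColumnContraction

variable {C : Type*} [Category* C] [Preadditive C]
  {K : HomologicalComplex₂ C (ComplexShape.down ℕ) (ComplexShape.down ℕ)}
  {L : ChainComplex C ℕ} (e : K.ColumnContraction L)
  [K.HasTotal (ComplexShape.down ℕ)]

local notation "cN" => ComplexShape.down ℕ

/-- The component of the projection of the total complex. -/
def projX (n : ℕ) : (K.total cN).X n ⟶ L.X n :=
  K.totalDesc fun p q hpq =>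
    match p, hpq with
    | 0, hpq => e.ε.f q ≫ eqToHom (by congr 1; simpa using! hpq)
    | _ + 1, _ => 0

lemma ι_projX_zero (n : ℕ) (h : ComplexShape.π cN cN cN (0, n) = n) :
    K.ιTotal cN 0 n n h ≫ e.projX n = e.ε.f n := by
  simp [projX]

lemma ι_projX_succ (p q n : ℕ) (h : ComplexShape.π cN cN cN (p + 1, q) = n) :
    K.ιTotal cN (p + 1) q n h ≫ e.projX n = 0 := by
  simp [projX]

/-- The component of the inclusion into the total complex. -/
def inclX (n : ℕ) : L.X n ⟶ (K.total cN).X n :=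
  e.s.f n ≫ K.ιTotal cN 0 n n (zero_add n)

/-- The component of the homotopy on the total complex. -/
def htpyX (n m : ℕ) (hnm : n + 1 = m) : (K.total cN).X n ⟶ (K.total cN).X m :=
  K.totalDesc fun p q hpq => (e.h p).f q ≫ K.ιTotal cN (p + 1) q m (by
    change p + q = n at hpq
    change p + 1 + q = m
    lia)

@[simp]
lemma ι_htpyX (n m : ℕ) (hnm : n + 1 = m) (p q : ℕ) (hpq : ComplexShape.π cN cN cN (p, q) = n) :
    K.ιTotal cN p q n hpq ≫ e.htpyX n m hnm = (e.h p).f q ≫ K.ιTotal cN (p + 1) q m (by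
    change p + q = n at hpq
    change p + 1 + q = m
    lia) := by
  simp [htpyX]

/-- The projection of the total complex to the complex `L`. -/
def proj : K.total cN ⟶ L where
  f := e.projX
  comm' := by
    rintro _ n rfl
    ext p q hpq
    rcases p with _ | p
    · obtain rfl : q = n + 1 := (zero_add q).symm.trans hpq
      rw [reassoc_of% e.ι_projX_zero, reassoc_of% K.ι_total_d_zero_succ n (n + 1) n hpq rfl,
        ι_projX_zero, HomologicalComplex.Hom.comm]
    · rw [reassoc_of% e.ι_projX_succ, zero_comp]
      rcases q with _ | q
      · obtain rfl : p = n := by change p + 1 + 0 = n + 1 at hpq; lia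
        rw [reassoc_of% K.ι_total_d_succ_zero p (p + 1) p hpq rfl]
        rcases p with _ | p
        · rw [ι_projX_zero, ← HomologicalComplex.comp_f, e.d_ε, HomologicalComplex.zero_f]
        · rw [ι_projX_succ, comp_zero]
      · rw [reassoc_of% K.ι_total_d_succ_succ p q (n + 1) n hpq rfl, Preadditive.add_comp,
          Linear.units_smul_comp, Category.assoc, Category.assoc, ι_projX_succ, comp_zero,
          smul_zero, add_zero]
        rcases p with _ | p
        · obtain rfl : q + 1 = n := by change 0 + 1 + (q + 1) = n + 1 at hpq; lia
          rw [ι_projX_zero, ← HomologicalComplex.comp_f, e.d_ε, HomologicalComplex.zero_f]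
        · rw [ι_projX_succ, comp_zero]

/-- The inclusion of the complex `L` into the total complex. -/
def incl : L ⟶ K.total cN where
  f := e.inclX
  comm' := by
    rintro _ n rfl
    rw [inclX, Category.assoc, K.ι_total_d_zero_succ n (n + 1) n (zero_add _) rfl,
      e.s.comm_assoc, inclX]

/-- The identity of the total complex is homotopic to a map that factors through `L`. -/
def homotopy : Homotopy (𝟙 (K.total cN)) (e.proj ≫ e.incl) := by
  refine .trans (.ofEq ?_) (((Homotopy.nullHomotopy' fun i j hij => e.htpyX i j hij).add
    (Homotopy.refl (e.proj ≫ e.incl))).trans (.ofEq (zero_add _)))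
  have h₀ (q : ℕ) := HomologicalComplex.congr_hom e.comm_zero q
  have h₁ (p q : ℕ) := HomologicalComplex.congr_hom (e.comm_succ p) q
  dsimp at h₀ h₁
  ext n : 1
  change _ = _ + e.projX n ≫ e.inclX n
  rcases n with _ | n
  · rw [Homotopy.nullHomotopicMap'_f_of_not_rel_left (k₁ := 1) (k₀ := 0) rfl (by simp)]
    ext p q hpq
    obtain rfl : p = 0 := by change p + q = 0 at hpq; lia
    obtain rfl : q = 0 := by change 0 + q = 0 at hpq; lia
    rw [Preadditive.comp_add, reassoc_of% e.ι_htpyX, K.ι_total_d_succ_zero 0 1 0 rfl rfl,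
      reassoc_of% e.ι_projX_zero, inclX, ← Category.assoc, ← Category.assoc,
      ← Preadditive.add_comp, h₀]
    simp
  · rw [Homotopy.nullHomotopicMap'_f (k₂ := n + 2) (k₁ := n + 1) (k₀ := n) rfl rfl]
    ext p q hpq
    rw [Preadditive.comp_add, Preadditive.comp_add, reassoc_of% e.ι_htpyX]
    rcases p with _ | p
    · obtain rfl : q = n + 1 := (zero_add q).symm.trans hpq
      rw [reassoc_of% e.ι_projX_zero, inclX, K.ι_total_d_succ_succ 0 n (n + 2) (n + 1) (by lia) rfl,
        reassoc_of% K.ι_total_d_zero_succ n (n + 1) n hpq rfl, ι_htpyX, Preadditive.comp_add,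
        Linear.comp_units_smul, ← (e.h 0).comm_assoc, pow_succ, pow_zero, one_mul,
        Units.neg_smul, one_smul]
      -- The two mixed terms cancel: `h` commutes with the column differential, but it raises `p` by
      -- one and so changes the sign of that differential in the total complex.
      rw [add_left_comm, add_neg_cancel, add_zero, ← Category.assoc, ← Category.assoc,
        ← Preadditive.add_comp, h₀]
      simp
    · rw [reassoc_of% e.ι_projX_succ, zero_comp, add_zero]
      rcases q with _ | q
      · obtain rfl : p = n := by change p + 1 + 0 = n + 1 at hpq; lia
        rw [reassoc_of% K.ι_total_d_succ_zero p (p + 1) p hpq rfl, ι_htpyX,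
          K.ι_total_d_succ_zero (p + 1) (p + 2) (p + 1) rfl rfl, ← Category.assoc, ← Category.assoc,
          ← Preadditive.add_comp, add_comm (_ ≫ _), h₁]
        simp
      · rw [reassoc_of% K.ι_total_d_succ_succ p q (n + 1) n hpq rfl, Preadditive.add_comp,
          K.ι_total_d_succ_succ (p + 1) q (n + 2) (n + 1)
            (by change p + 1 + (q + 1) = n + 1 at hpq; lia) rfl, Preadditive.comp_add,
          Linear.comp_units_smul, Linear.units_smul_comp, Category.assoc, Category.assoc, ι_htpyX,
          ι_htpyX, ← (e.h (p + 1)).comm_assoc, pow_succ _ (p + 1), mul_neg, mul_one, Units.neg_smul]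
        rw [add_add_add_comm, add_neg_cancel, add_zero, ← Category.assoc, ← Category.assoc,
          ← Preadditive.add_comp, add_comm (_ ≫ _), h₁]
        simp

-- The identity on homology factors through the homology of `L`. Only this half of a homotopy
-- equivalence is needed, so `s ≫ ε = 𝟙` is not part of the data.
include e in
lemma exactAt_total [CategoryWithHomology C] {n : ℕ} (h : L.ExactAt n) :
    (K.total cN).ExactAt n := by
  rw [HomologicalComplex.exactAt_iff_isZero_homology] at h ⊢
  rw [IsZero.iff_id_eq_zero, ← HomologicalComplex.homologyMap_id, e.homotopy.homologyMap_eq,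
    HomologicalComplex.homologyMap_comp, h.eq_of_tgt (HomologicalComplex.homologyMap e.proj n) 0,
    zero_comp]

end HomologicalComplex₂.ColumnContraction

/-! ### Projective resolutions of length one -/

namespace CategoryTheory.ShortComplex

open Limits

variable {C : Type*} [Category* C] [Abelian C] (S : ShortComplex C)

/-- The two-term complex given by the first map of a short complex. -/
def twoTermComplex : ChainComplex C ℕ :=
  ChainComplex.augment ((ChainComplex.single₀ C).obj S.X₁) (X := S.X₂) S.f zero_comp

lemma isZero_twoTermComplex_X (n : ℕ) : IsZero (S.twoTermComplex.X (n + 2)) :=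
  HomologicalComplex.isZero_single_obj_X (ComplexShape.down ℕ) 0 S.X₁ (n + 1) (Nat.succ_ne_zero n)

variable {S} in
/-- A short exact sequence with projective first and second terms, as a projective resolution of
its third term. -/
def ShortExact.projectiveResolution (hS : S.ShortExact) [Projective S.X₁] [Projective S.X₂] :
    ProjectiveResolution S.X₃ where
  complex := S.twoTermComplex
  projective
    | 0 => inferInstanceAs (Projective S.X₂)
    | n + 1 => inferInstanceAs (Projective (((ChainComplex.single₀ C).obj S.X₁).X n))
  π := (ChainComplex.toSingle₀Equiv _ _).symm ⟨S.g, S.zero⟩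
  quasiIso := ⟨fun n => by
    have := hS.epi_g
    have := hS.mono_f
    rcases n with _ | n
    -- In degree zero the condition is exactness at `S.X₂` together with `S.g` epi; in degree one it
    -- is `S.f` mono; above that the terms vanish.
    · rw [ChainComplex.quasiIsoAt₀_iff, ShortComplex.quasiIso_iff_of_zeros']
      · refine (ShortComplex.exact_and_epi_g_iff_of_iso ?_).2 ⟨hS.exact, hS.epi_g⟩
        exact ShortComplex.isoMk (Iso.refl _) (Iso.refl _) (Iso.refl _)
          ((Category.id_comp _).trans (Category.comp_id _).symm)
          ((Category.id_comp S.g).trans ((ChainComplex.toSingle₀Equiv_symm_apply_f_zero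
            (C := S.twoTermComplex) S.g S.zero).symm.trans (Category.comp_id _).symm))
      all_goals rfl
    · rw [quasiIsoAt_iff_exactAt' _ _ (ChainComplex.exactAt_succ_single_obj _ _)]
      rcases n with _ | n
      · rw [HomologicalComplex.exactAt_iff' _ 2 1 0 (by simp) (by simp),
          ShortComplex.exact_iff_mono _ ((S.isZero_twoTermComplex_X 0).eq_of_src _ _)]
        exact hS.mono_f
      · rw [HomologicalComplex.exactAt_iff]
        exact ShortComplex.exact_of_isZero_X₂ _ (S.isZero_twoTermComplex_X n)⟩

end CategoryTheory.ShortComplex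

/-! ### Fox calculus and the homology of free groups -/

namespace Fox

open Rep Finsupp
open FreeGroup (of)

variable (k S : Type u) [CommRing k]

/-- The affine action of the free group on the free module with basis `S` whose linear part is the
regular action and for which the generator `s` sends `0` to the basis element `s`. -/
def foxAction : FreeGroup S →* Equiv.Perm (Rep.free k (FreeGroup S) S) :=
  FreeGroup.lift fun s =>
    { toFun := fun m => (Rep.free k (FreeGroup S) S).ρ (of s) m + single s (.single 1 1)
      invFun := fun m => (Rep.free k (FreeGroup S) S).ρ (of s)⁻¹ (m - single s (.single 1 1))
      left_inv := fun m => by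
        dsimp only
        rw [add_sub_cancel_right, Representation.inv_self_apply]
      right_inv := fun m => by
        dsimp only
        rw [Representation.self_inv_apply, sub_add_cancel] }

variable {S}

/-- The universal Fox derivative. -/
def fox (g : FreeGroup S) : Rep.free k (FreeGroup S) S := foxAction k S g 0

/-- Affine maps are closed under composition and inversion, so every word acts affinely with the
regular action as linear part; `fox` is its translation part. Realizing the derivation as an action
reduces its existence to the universal property of the free group. -/
lemma foxAction_apply (g : FreeGroup S) (m) :
    foxAction k S g m = (Rep.free k (FreeGroup S) S).ρ g m + fox k g := by
  have hof (s : S) (m) : foxAction k S (of s) m =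
      (Rep.free k (FreeGroup S) S).ρ (of s) m + single s (.single 1 1) := by
    simp [foxAction]
  have hm (g h : FreeGroup S)
      (hg : ∀ m, foxAction k S g m = (Rep.free k (FreeGroup S) S).ρ g m + fox k g)
      (hh : ∀ m, foxAction k S h m = (Rep.free k (FreeGroup S) S).ρ h m + fox k h) (m) :
      foxAction k S (g * h) m = (Rep.free k (FreeGroup S) S).ρ (g * h) m + fox k (g * h) := by
    rw [fox, map_mul, Equiv.Perm.mul_apply, Equiv.Perm.mul_apply, hh, hg, hg (foxAction k S h 0),
      hh 0, map_zero, zero_add, map_add, map_mul, Module.End.mul_apply, add_assoc]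
  induction g using FreeGroup.induction_on generalizing m with
  | C1 => simp [fox]
  | of s => rw [fox, hof, hof, map_zero, zero_add]
  | inv_of s ih =>
    have h (x) : foxAction k S (of s)⁻¹ x = (Rep.free k (FreeGroup S) S).ρ (of s)⁻¹
        (x - single s (.single 1 1)) := by
      rw [map_inv, Equiv.Perm.inv_eq_iff_eq, hof, Representation.self_inv_apply, sub_add_cancel]
    change foxAction k S (of s)⁻¹ m = (Rep.free k (FreeGroup S) S).ρ (of s)⁻¹ m + fox k (of s)⁻¹
    rw [fox, h, h, ← map_add]
    congr 1
    abel
  | mul g h hg hh => exact hm g h hg hh m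

lemma fox_of (s : S) : fox k (of s) = single s (.single 1 1) := by
  simp [fox, foxAction]

lemma fox_one : fox k (1 : FreeGroup S) = 0 := by
  simp [fox]

/-- The cocycle identity is the translation part of a composite of affine maps. -/
lemma fox_mul (g h : FreeGroup S) :
    fox k (g * h) = (Rep.free k (FreeGroup S) S).ρ g (fox k h) + fox k g := by
  rw [← foxAction_apply, fox, fox, map_mul, Equiv.Perm.mul_apply]

variable (S)

/-- The inclusion of the augmentation ideal, with its basis `s - 1`. -/
def augIncl : Rep.free k (FreeGroup S) S ⟶ leftRegular k (FreeGroup S) :=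
  Rep.freeLift k _ (leftRegular k (FreeGroup S)) fun s => (.single (of s) 1 - .single 1 1)

/-- The augmentation. -/
def aug : leftRegular k (FreeGroup S) ⟶ trivial k (FreeGroup S) k :=
  leftRegularHom (trivial k (FreeGroup S) k) 1

/-- The linear extension of the Fox derivative. -/
def foxLinear : (leftRegular k (FreeGroup S)).V →ₗ[k] (Rep.free k (FreeGroup S) S).V :=
  Finsupp.lift _ k (FreeGroup S) (fun g ↦ fox k g) ∘ₗ
    (MonoidAlgebra.coeffLinearEquiv _).toLinearMap

lemma foxLinear_single (g : FreeGroup S) (r : k) : foxLinear k S (.single g r) = r • fox k g := by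
  simp [foxLinear]

lemma augIncl_single (s : S) (g : FreeGroup S) :
    (augIncl k S).hom (single s (.single g 1)) = .single (g * of s) 1 - .single g 1 := by
  simp [augIncl]

/-- The basis element `g · s` goes to `gs - g`, and the cocycle identity returns `g · fox s`. Hence
the elements `s - 1` are independent over the group ring. -/
lemma foxLinear_augIncl (x) : foxLinear k S ((augIncl k S).hom x) = x := by
  have : foxLinear k S ∘ₗ (augIncl k S).hom.toLinearMap = LinearMap.id := by
    refine Finsupp.lhom_ext' fun s => MonoidAlgebra.lhom_ext' fun g => LinearMap.ext_ring ?_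
    change foxLinear k S ((augIncl k S).hom (single s (.single g 1))) = single s (.single g 1)
    rw [augIncl_single, map_sub, foxLinear_single, foxLinear_single, one_smul, one_smul, fox_mul,
      add_sub_cancel_right, fox_of]
    simp
  exact LinearMap.congr_fun this x

/-- The fundamental formula of Fox calculus: both sides are derivations with the same values on
generators. -/
lemma augIncl_fox (g : FreeGroup S) :
    (augIncl k S).hom (fox k g) = .single g 1 - .single 1 1 := by
  induction g using FreeGroup.induction_on with
  | C1 => simp [fox_one]
  | of s => rw [fox_of, augIncl_single, one_mul]
  | inv_of s ih =>
    -- Expanding `fox (s s⁻¹) = 0` gives `fox s⁻¹ = -s⁻¹ · fox s`.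
    have h := fox_mul k (of s) (of s)⁻¹
    rw [mul_inv_cancel, fox_one] at h
    have h2 := congrArg ((Rep.free k (FreeGroup S) S).ρ (of s)⁻¹)
      (eq_neg_of_add_eq_zero_left h.symm)
    rw [Representation.inv_self_apply] at h2
    change (augIncl k S).hom (fox k (of s)⁻¹) = _
    rw [h2, Rep.hom_comm_apply, map_neg, ih]
    simp
  | mul g h hg hh =>
    rw [fox_mul, map_add, Rep.hom_comm_apply, hg, hh, map_sub]
    simp

/-- With `foxLinear_augIncl` this splits the augmentation sequence over `k`; in particular the
kernel of `aug` lies in the image of `augIncl`. -/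
lemma augIncl_foxLinear (x) :
    (augIncl k S).hom (foxLinear k S x) = x - (aug k S).hom x • .single 1 1 := by
  have : (augIncl k S).hom.toLinearMap ∘ₗ foxLinear k S = LinearMap.id -
      (LinearMap.toSpanSingleton k _ (.single 1 1)) ∘ₗ (aug k S).hom.toLinearMap := by
    refine MonoidAlgebra.lhom_ext' fun g => LinearMap.ext_ring ?_
    change (augIncl k S).hom (foxLinear k S (.single g 1)) =
      .single g 1 - (aug k S).hom (.single g 1) • .single 1 1
    rw [foxLinear_single, one_smul, augIncl_fox]
    simp [aug]
  exact LinearMap.congr_fun this x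

lemma augIncl_aug : augIncl k S ≫ aug k S = 0 := by
  refine Rep.free_ext k (FreeGroup S) _ _ _ fun s => ?_
  change (aug k S).hom ((augIncl k S).hom _) = 0
  rw [augIncl_single, map_sub, sub_eq_zero]
  simp [aug]

/-- The augmentation sequence of a free group. -/
def augSequence : ShortComplex (Rep k (FreeGroup S)) :=
  ShortComplex.mk (augIncl k S) (aug k S) (augIncl_aug k S)

lemma augSequence_shortExact : (augSequence k S).ShortExact where
  exact := by
    rw [← ShortComplex.exact_map_iff_of_faithful _ (forget₂ (Rep k (FreeGroup S)) (ModuleCat k)),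
      ShortComplex.moduleCat_exact_iff]
    intro x hx
    refine ⟨foxLinear k S x, (augIncl_foxLinear k S x).trans ?_⟩
    rw [show (aug k S).hom x = 0 from hx, zero_smul]
    exact sub_zero _
  mono_f := (Rep.mono_iff_injective _).2 (Function.LeftInverse.injective (foxLinear_augIncl k S))
  epi_g := (Rep.epi_iff_surjective _).2 fun r => ⟨.single 1 r,
    (leftRegularHom_hom_single _ _ _).trans (mul_one (M := k) r)⟩

instance : Projective (augSequence k S).X₁ :=
  Rep.free_projective.{u, u} (k := k) (G := FreeGroup S) (α := S)

instance : Projective (augSequence k S).X₂ :=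
  inferInstanceAs (Projective (leftRegular.{u, u} k (FreeGroup S)))

/-- The augmentation sequence is a projective resolution of length one, so homology vanishes from
degree two on. -/
lemma exactAt_inhomogeneousChains (A : Rep k (FreeGroup S)) (n : ℕ) :
    (groupHomology.inhomogeneousChains A).ExactAt (n + 2) := by
  classical
  rw [HomologicalComplex.exactAt_iff_isZero_homology]
  refine Limits.IsZero.of_iso ?_ (groupHomologyIso A (n + 2)
    (augSequence_shortExact k S).projectiveResolution)
  rw [← HomologicalComplex.exactAt_iff_isZero_homology, HomologicalComplex.exactAt_iff]
  exact ShortComplex.exact_of_isZero_X₂ _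
    (((coinvariantsTensor k (FreeGroup S)).obj A).map_isZero
      ((augSequence k S).isZero_twoTermComplex_X n))

end Fox

/-! ### Balancing a double complex by dimension shifting -/

namespace ChainComplex

open Limits HomologicalComplex

variable {A : Type*} [Category* A] [Abelian A]

section

variable (D : ChainComplex A ℕ)

/-- The sequence `opcycles (k + 1) ⟶ X k ⟶ opcycles k`. -/
def opcyclesSequence (k : ℕ) : ShortComplex A :=
  ShortComplex.mk (D.fromOpcycles (k + 1) k) (D.pOpcycles k) (by
    rw [← cancel_epi (D.pOpcycles (k + 1)), p_fromOpcycles_assoc, d_pOpcycles, comp_zero])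

-- The kernel of `opcycles (k + 1) ⟶ X k` is the homology in degree `k + 1`, which vanishes; its
-- image is that of the differential, since `X (k + 1)` maps onto `opcycles (k + 1)`.
variable {D} in
lemma opcyclesSequence_shortExact (k : ℕ) (hD : D.ExactAt (k + 1)) :
    (D.opcyclesSequence k).ShortExact where
  exact := by
    let T := ShortComplex.mk (D.d (k + 1) k) (D.pOpcycles k) (by simp)
    have hT : T.Exact := T.exact_of_g_is_cokernel (D.opcyclesIsCokernel (k + 1) k (by simp))
    let φ : T ⟶ D.opcyclesSequence k :=
      { τ₁ := D.pOpcycles (k + 1)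
        τ₂ := 𝟙 _
        τ₃ := 𝟙 _
        comm₁₂ := by simp [T, opcyclesSequence]
        comm₂₃ := by simp [T, opcyclesSequence] }
    have : Epi φ.τ₁ := inferInstanceAs (Epi (D.pOpcycles (k + 1)))
    have : IsIso φ.τ₂ := inferInstanceAs (IsIso (𝟙 _))
    have : Mono φ.τ₃ := inferInstanceAs (Mono (𝟙 _))
    exact (ShortComplex.exact_iff_of_epi_of_isIso_of_mono φ).1 hT
  mono_f := Preadditive.mono_of_isZero_kernel' _ (D.homologyIsKernel (k + 1) k (by simp))
    (D.exactAt_iff_isZero_homology _ |>.1 hD)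
  epi_g := inferInstanceAs (Epi (D.pOpcycles k))

end

/-- In degree zero, homology is a quotient of the term of the complex. -/
lemma epi_homologyMap_zero {X Y : ChainComplex A ℕ} (f : X ⟶ Y) [Epi f] :
    Epi (homologyMap f 0) := by
  have : Epi (homologyMap f 0 ≫ Y.homologyι 0) := by
    rw [homologyι_naturality]
    infer_instance
  rw [← Category.comp_id (homologyMap f 0), ← IsIso.hom_inv_id (Y.homologyι 0), ← Category.assoc]
  infer_instance

variable {D : ChainComplex (ChainComplex A ℕ) ℕ}

variable (D) in
/-- The complex of homology objects in degree zero. -/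
def homologyZero : ChainComplex A ℕ :=
  ((homologyFunctor A (ComplexShape.down ℕ) 0).mapHomologicalComplex _).obj D

/-- The map in degree zero homology induced by `fromOpcycles`. -/
def homologyFromOpcycles (D : ChainComplex (ChainComplex A ℕ) ℕ) (k : ℕ) :
    (D.opcycles (k + 1)).homology 0 ⟶ D.homologyZero.X k :=
  homologyMap (D.fromOpcycles (k + 1) k) 0

section

variable (hD : ∀ k, D.ExactAt (k + 1)) (k : ℕ)

include hD

/-- Take `H₀` of the short exact sequence of opcycles, then precompose its first map with the
epimorphism `H₀(X (k + 1)) ⟶ H₀(opcycles (k + 1))`. -/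
lemma exact_homologyMap_pOpcycles :
    (ShortComplex.mk (D.homologyZero.d (k + 1) k) (homologyMap (D.pOpcycles k) 0) (by
      change homologyMap (D.d (k + 1) k) 0 ≫ _ = 0
      rw [← homologyMap_comp, d_pOpcycles, homologyMap_zero])).Exact := by
  let T := ShortComplex.mk (homologyMap (D.fromOpcycles (k + 1) k) 0)
    (homologyMap (D.pOpcycles k) 0) (by
      rw [← homologyMap_comp]
      exact (congrArg (homologyMap · 0) (D.opcyclesSequence k).zero).trans (homologyMap_zero _ _ _))
  have hT : T.Exact := (opcyclesSequence_shortExact k (hD k)).homology_exact₂ 0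
  let T' := ShortComplex.mk (D.homologyZero.d (k + 1) k) (homologyMap (D.pOpcycles k) 0) (by
      change homologyMap (D.d (k + 1) k) 0 ≫ _ = 0
      rw [← homologyMap_comp, d_pOpcycles, homologyMap_zero])
  let φ : T' ⟶ T :=
    { τ₁ := homologyMap (D.pOpcycles (k + 1)) 0
      τ₂ := 𝟙 _
      τ₃ := 𝟙 _
      comm₁₂ := by
        change homologyMap _ 0 ≫ homologyMap _ 0 = homologyMap (D.d (k + 1) k) 0 ≫ 𝟙 _
        rw [← homologyMap_comp, p_fromOpcycles, Category.comp_id]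
      comm₂₃ := (Category.id_comp _).trans (Category.comp_id _).symm }
  have : Epi φ.τ₁ := epi_homologyMap_zero (D.pOpcycles (k + 1))
  have : IsIso φ.τ₂ := inferInstanceAs (IsIso (𝟙 _))
  have : Mono φ.τ₃ := inferInstanceAs (Mono (𝟙 _))
  exact (ShortComplex.exact_iff_of_epi_of_isIso_of_mono φ).2 hT

/-- Homology in degree zero commutes with `opcycles`. -/
def homologyZeroOpcyclesIso : D.homologyZero.opcycles k ≅ (D.opcycles k).homology 0 :=
  haveI : Epi (ShortComplex.mk (D.homologyZero.d (k + 1) k) (homologyMap (D.pOpcycles k) 0) (by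
      change homologyMap (D.d (k + 1) k) 0 ≫ _ = 0
      rw [← homologyMap_comp, d_pOpcycles, homologyMap_zero])).g :=
    epi_homologyMap_zero (D.pOpcycles k)
  (D.homologyZero.opcyclesIsCokernel (k + 1) k (by simp)).coconePointUniqueUpToIso
    (ShortComplex.Exact.gIsCokernel (exact_homologyMap_pOpcycles hD k))

lemma pOpcycles_homologyZeroOpcyclesIso_hom :
    D.homologyZero.pOpcycles k ≫ (homologyZeroOpcyclesIso hD k).hom =
      homologyMap (D.pOpcycles k) 0 :=
  haveI : Epi (ShortComplex.mk (D.homologyZero.d (k + 1) k) (homologyMap (D.pOpcycles k) 0) (by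
      change homologyMap (D.d (k + 1) k) 0 ≫ _ = 0
      rw [← homologyMap_comp, d_pOpcycles, homologyMap_zero])).g :=
    epi_homologyMap_zero (D.pOpcycles k)
  (D.homologyZero.opcyclesIsCokernel (k + 1) k (by simp)).comp_coconePointUniqueUpToIso_hom
    (ShortComplex.Exact.gIsCokernel (exact_homologyMap_pOpcycles hD k)) WalkingParallelPair.one

lemma homologyZeroOpcyclesIso_hom_fromOpcycles :
    (homologyZeroOpcyclesIso hD (k + 1)).hom ≫ homologyFromOpcycles D k =
      D.homologyZero.fromOpcycles (k + 1) k := by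
  rw [← cancel_epi (D.homologyZero.pOpcycles (k + 1)), p_fromOpcycles, ← Category.assoc,
    pOpcycles_homologyZeroOpcyclesIso_hom]
  exact (homologyMap_comp _ _ _).symm.trans
    (congrArg (homologyMap · 0) (D.p_fromOpcycles (k + 1) k))

variable (hcol : ∀ k n, (D.X k).ExactAt (n + 1))
include hcol

/-- Since `H₁(X k) = 0`, the connecting map identifies `H₁(opcycles k)` with the kernel of
`H₀(opcycles (k + 1)) ⟶ H₀(X k)`. As `H₀` commutes with opcycles, this kernel is the homology of
`homologyZero` in degree `k + 1`. -/
lemma nonempty_homology_one_iso :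
    Nonempty ((D.opcycles k).homology 1 ≅ D.homologyZero.homology (k + 1)) := by
  have hS := opcyclesSequence_shortExact k (hD k)
  have := hS.mono_δ 1 0 rfl ((D.X k).exactAt_iff_isZero_homology _ |>.1 (hcol k 0))
  have e := (hS.homology_exact₁ 1 0 rfl).fIsKernel
  refine ⟨IsLimit.conePointsIsoOfNatIso e (D.homologyZero.homologyIsKernel (k + 1) k (by simp))
    (parallelPair.ext (homologyZeroOpcyclesIso hD (k + 1)).symm (Iso.refl _) ?_ ?_)⟩
  · change homologyFromOpcycles D k ≫ 𝟙 _ =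
      (homologyZeroOpcyclesIso hD (k + 1)).inv ≫ D.homologyZero.fromOpcycles (k + 1) k
    rw [← homologyZeroOpcyclesIso_hom_fromOpcycles hD, Iso.inv_hom_id_assoc]
    exact Category.comp_id _
  · change 0 ≫ _ = _ ≫ 0
    rw [zero_comp, comp_zero]

lemma nonempty_homology_opcycles_iso (n : ℕ) (k m : ℕ) (h : m = k + n + 1) :
    Nonempty ((D.opcycles k).homology (n + 1) ≅ D.homologyZero.homology m) := by
  induction n generalizing k with
  | zero =>
    subst h
    exact nonempty_homology_one_iso hD k hcol
  | succ n ih =>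
    obtain ⟨e⟩ := ih (k + 1) (by lia)
    -- The column `X k` has no homology in degrees `n + 2` and `n + 1`, so the connecting map is an
    -- isomorphism: `k` rises by one as `n` drops by one.
    exact ⟨(opcyclesSequence_shortExact k (hD k)).δIso (n + 2) (n + 1) rfl
      ((D.X k).exactAt_iff_isZero_homology _ |>.1 (hcol k _))
      ((D.X k).exactAt_iff_isZero_homology _ |>.1 (hcol k _)) ≪≫ e⟩

/-- Balancing: if a double complex is a resolution in both directions, the complexes that it
resolves have the same homology. -/
theorem nonempty_homology_iso_of_augmentation {T : ChainComplex A ℕ} (π : D.X 0 ⟶ T)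
    (w : D.d 1 0 ≫ π = 0) [Epi π] (hπ : (ShortComplex.mk _ _ w).Exact) (n : ℕ) :
    Nonempty (D.homologyZero.homology n ≅ T.homology n) := by
  have e : D.opcycles 0 ≅ T :=
    (D.opcyclesIsCokernel 1 0 (by simp)).coconePointUniqueUpToIso hπ.gIsCokernel
  suffices h : Nonempty ((D.opcycles 0).homology n ≅ D.homologyZero.homology n) from
    h.elim fun f => ⟨f.symm ≪≫ (homologyFunctor A (ComplexShape.down ℕ) n).mapIso e⟩
  rcases n with _ | n
  · exact ⟨(homologyZeroOpcyclesIso hD 0).symm ≪≫ D.homologyZero.isoHomologyι₀.symm⟩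
  · exact nonempty_homology_opcycles_iso hD hcol n 0 (n + 1) (by lia)

end

end ChainComplex

/-! ### Contractions from an extra degeneracy -/

namespace CategoryTheory.SimplicialObject

open AlgebraicTopology

universe v w

variable {V : Type w} [Category.{v} V] [Preadditive V] (Y : SimplicialObject V)

lemma alternatingFaceMapComplex_d (n : ℕ) :
    ((alternatingFaceMapComplex V).obj Y).d (n + 1) n =
      ∑ i : Fin (n + 2), (-1 : ℤ) ^ (i : ℕ) • Y.δ i := by
  simp [AlternatingFaceMapComplex.objD]

lemma alternatingFaceMapComplex_d_one_zero :
    ((alternatingFaceMapComplex V).obj Y).d 1 0 = Y.δ (0 : Fin 2) - Y.δ (1 : Fin 2) := by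
  rw [alternatingFaceMapComplex_d, Fin.sum_univ_two]
  simp [sub_eq_add_neg]

variable {Y} (h : ∀ n, ((alternatingFaceMapComplex V).obj Y).X n ⟶
  ((alternatingFaceMapComplex V).obj Y).X (n + 1))
  (h_zero : ∀ n, h n ≫ Y.δ (0 : Fin (n + 2)) = 𝟙 _)

include h_zero

lemma contraction_d_zero {L : V} (ε : ((alternatingFaceMapComplex V).obj Y).X 0 ⟶ L)
    (s : L ⟶ ((alternatingFaceMapComplex V).obj Y).X 0) (h_one : h 0 ≫ Y.δ (1 : Fin 2) = ε ≫ s) :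
    h 0 ≫ ((alternatingFaceMapComplex V).obj Y).d 1 0 + ε ≫ s = 𝟙 _ := by
  have h0 : h 0 ≫ Y.δ (0 : Fin 2) = 𝟙 _ := h_zero 0
  rw [alternatingFaceMapComplex_d_one_zero]
  exact (congrArg (· + ε ≫ s) ((Preadditive.comp_sub _ _ _).trans (congrArg₂ _ h0 h_one))).trans
    (sub_add_cancel _ _)

/-- The face `i + 1` after `h` equals `h` after the face `i`, and the two carry opposite signs.
Everything cancels except the face `0` after `h`, the identity. -/
lemma contraction_d_succ
    (h_succ : ∀ n (i : Fin (n + 2)), h (n + 1) ≫ Y.δ i.succ = Y.δ i ≫ h n) (n : ℕ) :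
    h (n + 1) ≫ ((alternatingFaceMapComplex V).obj Y).d (n + 2) (n + 1) +
      ((alternatingFaceMapComplex V).obj Y).d (n + 1) n ≫ h n = 𝟙 _ := by
  let δ (n : ℕ) (i : Fin (n + 2)) : ((alternatingFaceMapComplex V).obj Y).X (n + 1) ⟶
    ((alternatingFaceMapComplex V).obj Y).X n := Y.δ i
  have hd (n : ℕ) : ((alternatingFaceMapComplex V).obj Y).d (n + 1) n =
      ∑ i : Fin (n + 2), (-1 : ℤ) ^ (i : ℕ) • δ n i := alternatingFaceMapComplex_d Y n
  have h0 : h (n + 1) ≫ δ (n + 1) 0 = 𝟙 _ := h_zero (n + 1)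
  have h1 (i : Fin (n + 2)) : h (n + 1) ≫ δ (n + 1) i.succ = δ n i ≫ h n := h_succ n i
  rw [hd, hd, Fin.sum_univ_succ, Preadditive.comp_add, Preadditive.comp_zsmul, h0,
    Preadditive.comp_sum, Preadditive.sum_comp, add_assoc, ← Finset.sum_add_distrib,
    Finset.sum_eq_zero]
  · simp
  · intro i _
    rw [Preadditive.comp_zsmul, h1, Preadditive.zsmul_comp, ← add_smul, Fin.val_succ, pow_succ]
    simp

end CategoryTheory.SimplicialObject

/-! ### Contracting the cotriple resolution by a natural section of the counit -/

namespace Cotriple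

open Limits AlgebraicTopology

universe v w v' w'

variable {C : Type w} [Category.{v} C] (P : Comonad C)

/-- The bottom case of `resolution_δ_succ`: here the map under `P` is the augmentation `ε_X`, not a
face of the resolution. -/
theorem resolution_δ_one (X : C) :
    ((resolution P).obj X).δ (1 : Fin 2) = P.map (P.ε.app X) := by
  let α : Fin 1 →o Fin 2 := (SimplexCategory.δ (1 : Fin 2)).toOrderHom
  have h0 : α 0 = 0 := rfl
  have h : ∀ j, dropFirst α j ≠ 0 := fun j => j.elim0
  have h' : ∀ j, dropZero (dropFirst α) h j ≠ 0 := fun j => j.elim0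
  have e : dropZero (dropZero (dropFirst α) h) h' = OrderHom.id := by
    ext j; exact j.elim0
  change (powerMap P α).app X = _
  rw [powerMap_dot α h0, powerMap_bar _ h, powerMap_bar _ h', e, powerMap_id, Category.comp_id,
    lift_comp, ← Category.assoc, del_lift_eps, Category.id_comp]
  rfl

theorem resolution_augmentation (X : C) :
    ((resolution P).obj X).δ (0 : Fin 2) ≫ P.ε.app X =
      ((resolution P).obj X).δ (1 : Fin 2) ≫ P.ε.app X := by
  rw [resolution_δ_one, resolution_δ_zero]
  exact (P.ε.naturality (P.ε.app X)).symm

section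

variable {V : Type w'} [Category.{v'} V] [Preadditive V] {P}

/-- A natural section of the map `M(ε)`. -/
structure CounitSection (M : C ⥤ V) where
  s : M ⟶ P.toFunctor ⋙ M
  s_ε (X : C) : s.app X ≫ M.map (P.ε.app X) = 𝟙 _

variable {M : C ⥤ V} (σ : CounitSection (P := P) M) (X : C)

/-- The complex `M(P_* X)`. -/
abbrev cotripleComplex (P : Comonad C) (M : C ⥤ V) (X : C) : ChainComplex V ℕ :=
  (alternatingFaceMapComplex V).obj (((SimplicialObject.whiskering C V).obj M).obj
    ((resolution P).obj X))

variable (M) in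
/-- The faces of `M(P_* X)`. -/
def cotripleFace (n : ℕ) (i : Fin (n + 2)) :
    (cotripleComplex P M X).X (n + 1) ⟶ (cotripleComplex P M X).X n :=
  M.map (((resolution P).obj X).δ i)

variable (M) in
/-- The augmentation of `M(P_* X)`. -/
def cotripleAug : (cotripleComplex P M X).X 0 ⟶ M.obj X :=
  M.map (P.ε.app X)

lemma cotripleComplex_d (n : ℕ) : (cotripleComplex P M X).d (n + 1) n =
    ∑ i : Fin (n + 2), (-1 : ℤ) ^ (i : ℕ) • cotripleFace M X n i :=
  SimplicialObject.alternatingFaceMapComplex_d _ n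

lemma cotripleComplex_d_aug : (cotripleComplex P M X).d 1 0 ≫ cotripleAug M X = 0 := by
  have h : cotripleFace (P := P) M X 0 0 ≫ cotripleAug M X =
      cotripleFace M X 0 1 ≫ cotripleAug M X :=
    (M.map_comp _ _).symm.trans ((congrArg M.map (resolution_augmentation P X)).trans
      (M.map_comp _ _))
  rw [cotripleComplex_d, Fin.sum_univ_two, Preadditive.add_comp, Preadditive.zsmul_comp,
    Preadditive.zsmul_comp, h, ← add_smul]
  exact zero_smul _ _

/-- The contracting homotopy of `M(P_* X)`. -/
def CounitSection.contraction (n : ℕ) :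
    (cotripleComplex P M X).X n ⟶ (cotripleComplex P M X).X (n + 1) :=
  σ.s.app ((power P (n + 1)).obj X)

/-- The section of the augmentation of `M(P_* X)`. -/
def CounitSection.augSection : M.obj X ⟶ (cotripleComplex P M X).X 0 :=
  σ.s.app X

lemma CounitSection.contraction_face_zero (n : ℕ) :
    σ.contraction X n ≫ cotripleFace M X n 0 = 𝟙 _ := by
  rw [cotripleFace, resolution_δ_zero]
  exact σ.s_ε _

/-- As the face `i + 1` is `P` applied to the face `i`, this is naturality of the section. -/
lemma CounitSection.contraction_face_succ (n : ℕ) (i : Fin (n + 2)) :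
    σ.contraction X (n + 1) ≫ cotripleFace M X (n + 1) i.succ =
      cotripleFace M X n i ≫ σ.contraction X n := by
  rw [cotripleFace, resolution_δ_succ]
  exact (σ.s.naturality (((resolution P).obj X).δ i)).symm

lemma CounitSection.contraction_face_one :
    σ.contraction X 0 ≫ cotripleFace M X 0 1 = cotripleAug M X ≫ σ.augSection X := by
  rw [cotripleFace, resolution_δ_one]
  exact (σ.s.naturality (P.ε.app X)).symm

lemma CounitSection.contraction_d_zero :
    σ.contraction X 0 ≫ (cotripleComplex P M X).d 1 0 + cotripleAug M X ≫ σ.augSection X =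
      𝟙 _ :=
  SimplicialObject.contraction_d_zero _ (σ.contraction_face_zero X) _ _ (σ.contraction_face_one X)

lemma CounitSection.contraction_d_succ (n : ℕ) :
    σ.contraction X (n + 1) ≫ (cotripleComplex P M X).d (n + 2) (n + 1) +
      (cotripleComplex P M X).d (n + 1) n ≫ σ.contraction X n = 𝟙 _ :=
  SimplicialObject.contraction_d_succ _ (σ.contraction_face_zero X)
    (σ.contraction_face_succ X) n

end

section

variable {R : Type u} [Ring R] (T : C ⥤ ChainComplex (ModuleCat.{u} R) ℕ) {P} (X : C)

lemma cotripleComplex_d_f (n m : ℕ) : ((cotripleComplex P T X).d (n + 1) n).f m =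
    (cotripleComplex P (T ⋙ HomologicalComplex.eval _ _ m) X).d (n + 1) n := by
  rw [cotripleComplex_d, cotripleComplex_d]
  exact (map_sum (HomologicalComplex.eval (ModuleCat.{u} R) (ComplexShape.down ℕ) m).mapAddHom
    _ _).trans (Finset.sum_congr rfl fun i _ => map_zsmul
      (HomologicalComplex.eval (ModuleCat.{u} R) (ComplexShape.down ℕ) m).mapAddHom _ _)

variable (σ : ∀ m, CounitSection (P := P) (T ⋙ HomologicalComplex.eval _ _ m))

include σ

/-- Exactness of a sequence of complexes is tested degreewise, so the sections for different `m`
need not commute with the differential of `T`. -/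
lemma exactAt_cotripleComplex (n : ℕ) : (cotripleComplex P T X).ExactAt (n + 1) := by
  rw [HomologicalComplex.exactAt_iff' _ (n + 2) (n + 1) n (by simp) (by simp)]
  refine HomologicalComplex.exact_of_degreewise_exact _ fun m => ?_
  rw [ShortComplex.moduleCat_exact_iff]
  intro x hx
  refine ⟨(σ m).contraction X (n + 1) x, ?_⟩
  have h := ConcreteCategory.congr_hom ((σ m).contraction_d_succ X n) x
  have hx' : (cotripleComplex P (T ⋙ HomologicalComplex.eval _ _ m) X).d (n + 1) n x = 0 := by
    rw [← cotripleComplex_d_f]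
    exact hx
  change ((cotripleComplex P T X).d (n + 2) (n + 1)).f m _ = _
  rw [cotripleComplex_d_f]
  change (cotripleComplex P (T ⋙ HomologicalComplex.eval _ _ m) X).d (n + 2) (n + 1)
    ((σ m).contraction X (n + 1) x) + (σ m).contraction X n
    ((cotripleComplex P (T ⋙ HomologicalComplex.eval _ _ m) X).d (n + 1) n x) = x at h
  rw [hx', map_zero, add_zero] at h
  exact h

lemma epi_cotripleAug : Epi (cotripleAug (P := P) T X) := by
  have (m : ℕ) : Epi ((cotripleAug (P := P) T X).f m) :=
    (SplitEpi.mk ((σ m).s.app X) ((σ m).s_ε X)).epi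
  exact HomologicalComplex.epi_of_epi_f _ this

lemma exact_cotripleAug :
    (ShortComplex.mk ((cotripleComplex P T X).d 1 0) (cotripleAug T X)
      (cotripleComplex_d_aug X)).Exact := by
  refine HomologicalComplex.exact_of_degreewise_exact _ fun m => ?_
  rw [ShortComplex.moduleCat_exact_iff]
  intro x hx
  refine ⟨(σ m).contraction X 0 x, ?_⟩
  have h := ConcreteCategory.congr_hom ((σ m).contraction_d_zero X) x
  change ((cotripleComplex P T X).d 1 0).f m _ = _
  rw [cotripleComplex_d_f]
  change (cotripleComplex P (T ⋙ HomologicalComplex.eval _ _ m) X).d 1 0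
    ((σ m).contraction X 0 x) + (σ m).augSection X ((cotripleAug T X).f m x) = x at h
  have hx' : (σ m).augSection X ((cotripleAug T X).f m x) = 0 :=
    (congrArg ((σ m).augSection X) hx).trans (map_zero ((σ m).augSection X).hom)
  rw [hx', add_zero] at h
  exact h

/-- Homology of `T X` from the resolution, if `T` is acyclic on the objects `P Y`. -/
theorem nonempty_homology_iso (hT : ∀ Y n, (T.obj (P.obj Y)).ExactAt (n + 1)) (n : ℕ) :
    Nonempty ((ChainComplex.homologyZero (cotripleComplex P T X)).homology n ≅
      (T.obj X).homology n) :=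
  haveI := epi_cotripleAug T X σ
  ChainComplex.nonempty_homology_iso_of_augmentation (exactAt_cotripleComplex T X σ)
    (fun k m => hT ((power P k).obj X) m) _ _ (exact_cotripleAug T X σ) n

end

end Cotriple

/-! ### Coordinates on the nerve and the section of the counit -/

namespace XMod

section Diagrams

variable (X : XMod.{u}) {J : Type} [Preorder J]

/-- The diagram with arrow `(kᵢ kⱼ⁻¹, μ(kⱼ) g)` at `i ≤ j`. -/
def diagramOf (k : J → X.H) (g : X.G) : X.diagrams J :=
  ⟨fun p => ⟨k p.1.1 * (k p.1.2)⁻¹, X.μ (k p.1.2) * g⟩,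
    fun i => by ext <;> simp [ident, src],
    fun i j h => by simp [src],
    fun i j h => by simp [src, tgt],
    fun i j l h h' => by ext <;> simp [compose]⟩

lemma mapDiagrams_diagramOf {Y : XMod.{u}} (φ : X ⟶ Y) (k : J → X.H) (g : X.G) :
    mapDiagrams φ J (X.diagramOf k g) = Y.diagramOf (fun i => φ.ρ (k i)) (φ.ν g) := by
  refine Subtype.ext (funext fun p => SemidirectProduct.ext ?_ ?_)
  · change φ.ρ (k p.1.1 * (k p.1.2)⁻¹) = φ.ρ (k p.1.1) * (φ.ρ (k p.1.2))⁻¹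
    rw [map_mul, map_inv]
  · change φ.ν (X.μ (k p.1.2) * g) = Y.μ (φ.ρ (k p.1.2)) * φ.ν g
    rw [map_mul, φ.comm]

variable [OrderTop J]

/-- The `H`-coordinates of a diagram. -/
def coordH (f : X.diagrams J) (i : J) : X.H := (f.1 ⟨(i, ⊤), le_top⟩).left

/-- The `G`-coordinate of a diagram. -/
def coordG (f : X.diagrams J) : X.G := (f.1 ⟨(⊤, ⊤), le_rfl⟩).right

/-- A diagram is determined by its last object and the arrows out of it: `f (i, j)` is `f (i, ⊤)`
composed with the inverse of `f (j, ⊤)`. -/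
lemma diagramOf_coord (f : X.diagrams J) : X.diagramOf (X.coordH f) (X.coordG f) = f := by
  refine Subtype.ext (funext fun ⟨⟨i, j⟩, hij⟩ => SemidirectProduct.ext ?_ ?_)
  · change (f.1 ⟨(i, ⊤), le_top⟩).left * (f.1 ⟨(j, ⊤), le_top⟩).left⁻¹ = _
    rw [f.2.2.2.2 i j ⊤ hij le_top]
    exact mul_inv_cancel_right _ _
  · refine Eq.trans ?_ ((f.2.2.2.1 j ⊤ le_top).trans (f.2.2.1 i j hij).symm)
    exact congrArg (X.μ _ * ·) (f.2.2.1 j ⊤ le_top).symm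

end Diagrams

section Section

variable (X : XMod.{u})

/-- The map `H → H(PX)` that sends `h` to the generator `(h, 1)`. -/
def sectionH (h : X.H) : (freeComonad.obj X).H := (freeUnit (S := X.H × X.G) (h, 1)).1

/-- The map `G → G(PX)` that sends `g` to the generator `(1, g)`. -/
def sectionG (g : X.G) : (freeComonad.obj X).G := (freeUnit (S := X.H × X.G) (1, g)).2

/-- A triangle identity of the free/forgetful adjunction. -/
lemma counit_freeUnit (s : X.H × X.G) :
    (((freeComonad.ε.app X).ρ (freeUnit s).1, (freeComonad.ε.app X).ν (freeUnit s).2) :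
      X.H × X.G) = s :=
  ConcreteCategory.congr_hom
    ((freeEquiv (X.H × X.G) X).apply_symm_apply (𝟙 (forgetToType.obj X))) s

lemma map_eq_freeEquiv_symm {Y : XMod.{u}} (φ : X ⟶ Y) :
    freeComonad.map φ = (freeEquiv (X.H × X.G) (free (Y.H × Y.G))).symm
      (forgetToType.map φ ≫ freeEquiv (Y.H × Y.G) (free (Y.H × Y.G)) (𝟙 _)) :=
  rfl

lemma freeEquiv_id_apply {S : Type u} (s : S) : freeEquiv S (free S) (𝟙 _) s = freeUnit s :=
  rfl

lemma map_freeUnit {Y : XMod.{u}} (φ : X ⟶ Y) (s : X.H × X.G) :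
    freeEquiv (X.H × X.G) (free (Y.H × Y.G)) (freeComonad.map φ) s =
      freeUnit (φ.ρ s.1, φ.ν s.2) := by
  rw [map_eq_freeEquiv_symm, Equiv.apply_symm_apply]
  exact freeEquiv_id_apply (S := Y.H × Y.G) _

lemma counit_sectionH (h : X.H) : (freeComonad.ε.app X).ρ (X.sectionH h) = h :=
  congrArg Prod.fst (X.counit_freeUnit (h, 1))

lemma counit_sectionG (g : X.G) : (freeComonad.ε.app X).ν (X.sectionG g) = g :=
  congrArg Prod.snd (X.counit_freeUnit (1, g))

/-- The unused entry of the generator is `1`, which every morphism preserves; this makes the section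
natural. -/
lemma map_sectionH {Y : XMod.{u}} (φ : X ⟶ Y) (h : X.H) :
    (freeComonad.map φ).ρ (X.sectionH h) = Y.sectionH (φ.ρ h) :=
  (congrArg Prod.fst (X.map_freeUnit φ (h, 1))).trans (by
    rw [map_one]
    rfl)

lemma map_sectionG {Y : XMod.{u}} (φ : X ⟶ Y) (g : X.G) :
    (freeComonad.map φ).ν (X.sectionG g) = Y.sectionG (φ.ν g) :=
  (congrArg Prod.snd (X.map_freeUnit φ (1, g))).trans (by
    rw [map_one]
    rfl)

variable {J : Type} [Preorder J] [OrderTop J]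

/-- A natural section, not compatible with multiplication, of the map that the counit induces on
diagrams. -/
def sectionDiagrams (f : X.diagrams J) : (freeComonad.obj X).diagrams J :=
  diagramOf _ (fun i => X.sectionH (X.coordH f i)) (X.sectionG (X.coordG f))

/-- The coordinate at `⊤` is `1` but is sent to a generator, not to `1`. This is harmless, since
`diagramOf` accepts arbitrary families `k`. -/
lemma counit_sectionDiagrams (f : X.diagrams J) :
    mapDiagrams (freeComonad.ε.app X) J (X.sectionDiagrams f) = f := by
  rw [sectionDiagrams, mapDiagrams_diagramOf]
  simp only [counit_sectionH, counit_sectionG]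
  exact diagramOf_coord X f

lemma map_sectionDiagrams {Y : XMod.{u}} (φ : X ⟶ Y) (f : X.diagrams J) :
    mapDiagrams (freeComonad.map φ) J (X.sectionDiagrams f) =
      Y.sectionDiagrams (mapDiagrams φ J f) := by
  rw [sectionDiagrams, mapDiagrams_diagramOf]
  simp only [map_sectionH, map_sectionG]
  rfl

end Section

/-! ### The natural section on chains -/

section Bicomplex

open HomologicalComplex₂

/-- The map of chain groups that a map of sets of diagrams induces. -/
def chainMapOfFun {X Y : XMod.{u}} (p q : ℕ)
    (σ : X.diagrams (Fin (p + 1)) → Y.diagrams (Fin (p + 1))) :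
    ((bicomplex.obj X).X p).X q ⟶ ((bicomplex.obj Y).X p).X q :=
  ModuleCat.ofHom (Finsupp.lmapDomain Int'.{u} Int'.{u}
    (fun x : Fin q → X.diagrams (Fin (p + 1)) => σ ∘ x))

lemma bicomplex_map_f_f {X Y : XMod.{u}} (φ : X ⟶ Y) (p q : ℕ) :
    ((bicomplex.map φ).f p).f q = chainMapOfFun p q (mapDiagrams φ (Fin (p + 1))) := by
  refine ModuleCat.hom_ext (Finsupp.lhom_ext fun x a => ?_)
  refine (groupHomology.chainsMap_f_single _ _ _ _ _).trans ?_
  exact (Finsupp.mapDomain_single (f := fun x : Fin q → X.diagrams (Fin (p + 1)) =>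
    mapDiagrams φ (Fin (p + 1)) ∘ x) (a := x) (b := a)).symm

lemma chainMapOfFun_comp {X Y Z : XMod.{u}} (p q : ℕ)
    (σ : X.diagrams (Fin (p + 1)) → Y.diagrams (Fin (p + 1)))
    (τ : Y.diagrams (Fin (p + 1)) → Z.diagrams (Fin (p + 1))) :
    chainMapOfFun p q σ ≫ chainMapOfFun p q τ = chainMapOfFun p q (τ ∘ σ) :=
  ModuleCat.hom_ext (Finsupp.lmapDomain_comp Int'.{u} Int'.{u} _ _).symm

lemma chainMapOfFun_id (X : XMod.{u}) (p q : ℕ) :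
    chainMapOfFun (X := X) p q id = 𝟙 _ :=
  ModuleCat.hom_ext (Finsupp.lmapDomain_id Int'.{u} Int'.{u})

/-- The total complex of the bicomplex of a crossed module. -/
def totalComplex : XMod.{u} ⥤ ChainComplex (ModuleCat.{u} Int'.{u}) ℕ :=
  bicomplex ⋙ HomologicalComplex₂.totalFunctor (ModuleCat.{u} Int'.{u})
      (ComplexShape.down ℕ) (ComplexShape.down ℕ) (ComplexShape.down ℕ)

/-- The total complex without its term of degree zero. -/
def truncatedComplex : XMod.{u} ⥤ ChainComplex (ModuleCat.{u} Int'.{u}) ℕ :=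
  totalComplex ⋙ ChainComplex.truncate

/-- The section of the map that the counit induces on the terms of the total complex. -/
def sectionTotal (X : XMod.{u}) (n : ℕ) :
    ((bicomplex.obj X).total (ComplexShape.down ℕ)).X n ⟶
      ((bicomplex.obj (freeComonad.obj X)).total (ComplexShape.down ℕ)).X n :=
  totalDesc _ fun p q h => chainMapOfFun p q X.sectionDiagrams ≫
    (bicomplex.obj (freeComonad.obj X)).ιTotal (ComplexShape.down ℕ) p q n h

lemma map_sectionTotal {X Y : XMod.{u}} (φ : X ⟶ Y) (n : ℕ) :
    (total.map (bicomplex.map φ) (ComplexShape.down ℕ)).f n ≫ Y.sectionTotal n =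
      X.sectionTotal n ≫
        (total.map (bicomplex.map (freeComonad.map φ)) (ComplexShape.down ℕ)).f n := by
  refine total.hom_ext _ fun p q h => ?_
  rw [sectionTotal, sectionTotal, ιTotal_map_assoc, ι_totalDesc, ι_totalDesc_assoc, Category.assoc,
    ιTotal_map, bicomplex_map_f_f, bicomplex_map_f_f, ← Category.assoc, ← Category.assoc,
    chainMapOfFun_comp, chainMapOfFun_comp]
  congr 2
  exact funext fun f => (X.map_sectionDiagrams φ f).symm

lemma sectionTotal_counit (X : XMod.{u}) (n : ℕ) :
    X.sectionTotal n ≫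
      (total.map (bicomplex.map (freeComonad.ε.app X)) (ComplexShape.down ℕ)).f n = 𝟙 _ := by
  refine total.hom_ext _ fun p q h => ?_
  have e : mapDiagrams (freeComonad.ε.app X) (Fin (p + 1)) ∘ X.sectionDiagrams = id :=
    funext X.counit_sectionDiagrams
  rw [sectionTotal, ι_totalDesc_assoc, Category.assoc, ιTotal_map, bicomplex_map_f_f,
    ← Category.assoc, chainMapOfFun_comp, Category.comp_id]
  refine Eq.trans ?_ (Category.id_comp _)
  rw [← chainMapOfFun_id, ← e]
  rfl

/-- A natural section of the map that the counit induces on the terms of the total complex. -/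
def totalCounitSection (n : ℕ) : Cotriple.CounitSection (P := freeComonad)
    (totalComplex.{u} ⋙ HomologicalComplex.eval _ _ n) where
  s :=
    { app X := X.sectionTotal n
      naturality _ _ φ := map_sectionTotal φ n }
  s_ε X := X.sectionTotal_counit n

/-- The homology of the truncated complex, from the cotriple resolution. -/
theorem nonempty_truncatedComplex_homology_iso
    (h : ∀ (S : Type u) n, (truncatedComplex.obj (free S)).ExactAt (n + 1))
    (X : XMod.{u}) (n : ℕ) :
    Nonempty ((ChainComplex.homologyZero
      (Cotriple.cotripleComplex freeComonad truncatedComplex X)).homology n ≅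
      (truncatedComplex.obj X).homology n) :=
  -- The degree `m` of the truncated complex is the degree `m + 1` of the total complex.
  Cotriple.nonempty_homology_iso truncatedComplex X (fun m => totalCounitSection (m + 1))
    (fun Y m => h (Y.H × Y.G) m) n

end Bicomplex

/-! ### The nerve of a normal subgroup with split quotient -/

section Inclusion

variable {G Q : Type u} [Group G] [Group Q] {N : Subgroup G} [N.Normal]

/-- The objects of a diagram. -/
def objects {J : Type} [Preorder J] (f : (inclusion N).diagrams J) (i : J) : G :=
  (f.1 ⟨(i, i), le_rfl⟩).right

/-- As `μ` is injective, an arrow is determined by its source and target. -/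
lemma diagrams_inclusion_ext {J : Type} [Preorder J] {f f' : (inclusion N).diagrams J}
    (h : ∀ i, objects f i = objects f' i) : f = f' := by
  have hr (i j : J) (hij : i ≤ j) : (f.1 ⟨(i, j), hij⟩).right = (f'.1 ⟨(i, j), hij⟩).right :=
    (f.2.2.1 i j hij).trans ((h j).trans (f'.2.2.1 i j hij).symm)
  refine Subtype.ext (funext fun ⟨⟨i, j⟩, hij⟩ => SemidirectProduct.ext ?_ (hr i j hij))
  have ht := (f.2.2.2.1 i j hij).trans ((h i).trans (f'.2.2.2.1 i j hij).symm)
  refine Subtype.ext (mul_right_cancel (b := (inclusion N).src (f.1 ⟨(i, j), hij⟩)) (ht.trans ?_))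
  exact congrArg (N.subtype (f'.1 ⟨(i, j), hij⟩).left * ·) (hr i j hij).symm

/-- A diagram in the internal category of a normal subgroup amounts to a family of congruent
elements. -/
def diagramOfObjects {J : Type} [Preorder J] (x : J → G) (hx : ∀ i j, x i * (x j)⁻¹ ∈ N) :
    (inclusion N).diagrams J :=
  ⟨fun p => ⟨⟨x p.1.1 * (x p.1.2)⁻¹, hx _ _⟩, x p.1.2⟩,
    fun i => SemidirectProduct.ext (Subtype.ext (mul_inv_cancel _)) rfl,
    fun i j h => rfl,
    fun i j h => inv_mul_cancel_right _ _,
    fun i j l h h' => SemidirectProduct.ext (Subtype.ext (by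
      change _ = x i * (x j)⁻¹ * (x j * (x l)⁻¹)
      simp)) rfl⟩

lemma objects_mem {n : ℕ} (f : (inclusion N).diagrams (Fin (n + 1))) (i j : Fin (n + 1)) :
    objects f i * (objects f j)⁻¹ ∈ N := by
  have key (i j : Fin (n + 1)) (hij : i ≤ j) : objects f i * (objects f j)⁻¹ ∈ N := by
    have h : N.subtype (f.1 ⟨(i, j), hij⟩).left * objects f j = objects f i :=
      (congrArg (N.subtype (f.1 ⟨(i, j), hij⟩).left * ·) (f.2.2.1 i j hij).symm).trans
        (f.2.2.2.1 i j hij)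
    rw [← h, mul_inv_cancel_right]
    exact Subtype.prop _
  rcases le_total i j with h | h
  · exact key i j h
  · simpa using N.inv_mem (key j i h)

variable {π : G →* Q} {σ : Q →* G} (hN : ∀ w ∈ N, π w = 1) (hπ : ∀ w, σ (π w) * w⁻¹ ∈ N)

include hN in
lemma map_objects {n : ℕ} (f : (inclusion N).diagrams (Fin (n + 1))) (i j : Fin (n + 1)) :
    π (objects f i) = π (objects f j) := by
  have h := hN _ (objects_mem f i j)
  rwa [map_mul, map_inv, mul_inv_eq_one] at h

/-- The homomorphism that adds the object `σ(π(x₀))` in front of `x₀, …, xₙ`. -/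
def prepend (n : ℕ) :
    (inclusion N).diagrams (Fin (n + 1)) →* (inclusion N).diagrams (Fin (n + 2)) where
  toFun f := diagramOfObjects (Fin.cons (σ (π (objects f 0))) (objects f)) fun i j => by
    have h (i : Fin (n + 1)) : σ (π (objects f 0)) * (objects f i)⁻¹ ∈ N := by
      have := N.mul_mem (hπ (objects f 0)) (objects_mem f 0 i)
      simpa [mul_assoc] using this
    refine Fin.cases ?_ (fun i => ?_) i <;> refine Fin.cases ?_ (fun j => ?_) j
    · simp
    · exact h j
    · simpa using N.inv_mem (h i)
    · exact objects_mem f i j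
  map_one' := diagrams_inclusion_ext (Fin.cases (by
    change σ (π 1) = 1
    simp) fun i => rfl)
  map_mul' f g := diagrams_inclusion_ext (Fin.cases (by
    change σ (π (objects f 0 * objects g 0)) = σ (π (objects f 0)) * σ (π (objects g 0))
    simp) fun i => rfl)

/-- The augmentation of the nerve of a normal subgroup. -/
def nerveAug (N : Subgroup G) [N.Normal] (π : G →* Q) :
    (inclusion N).diagrams (Fin (0 + 1)) →* Q where
  toFun f := π (objects f 0)
  map_one' := map_one π
  map_mul' _ _ := map_mul π _ _

/-- The section of the augmentation of the nerve. -/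
def nerveAugSection (N : Subgroup G) [N.Normal] (σ : Q →* G) :
    Q →* (inclusion N).diagrams (Fin (0 + 1)) where
  toFun q := diagramOfObjects (fun _ => σ q) fun _ _ => by simp
  map_one' := diagrams_inclusion_ext fun _ => map_one σ
  map_mul' _ _ := diagrams_inclusion_ext fun _ => map_mul σ _ _

lemma prepend_δ_zero (n : ℕ) :
    GrpCat.ofHom (prepend hπ n) ≫ (nerve.obj (inclusion N)).δ (0 : Fin (n + 2)) = 𝟙 _ :=
  GrpCat.hom_ext (MonoidHom.ext fun _ => diagrams_inclusion_ext fun _ => rfl)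

include hN in
lemma prepend_δ_succ (n : ℕ) (i : Fin (n + 2)) :
    GrpCat.ofHom (prepend hπ (n + 1)) ≫ (nerve.obj (inclusion N)).δ i.succ =
      (nerve.obj (inclusion N)).δ i ≫ GrpCat.ofHom (prepend hπ n) :=
  GrpCat.hom_ext (MonoidHom.ext fun f => diagrams_inclusion_ext fun j => by
    change Fin.cons (α := fun _ => G) (σ (π (objects f 0))) (objects f) (i.succ.succAbove j) =
      Fin.cons (α := fun _ => G) (σ (π (objects f (i.succAbove 0))))
        (fun j => objects f (i.succAbove j)) j
    refine Fin.cases ?_ (fun j => ?_) j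
    -- Omitting `x₀` changes the first object of the tuple, but not its class under `π`, so the
    -- object put in front is the same.
    · rw [Fin.succ_succAbove_zero, Fin.cons_zero, Fin.cons_zero, map_objects hN]
    · rw [Fin.succ_succAbove_succ, Fin.cons_succ, Fin.cons_succ])

lemma prepend_δ_one :
    GrpCat.ofHom (prepend hπ 0) ≫ (nerve.obj (inclusion N)).δ (1 : Fin 2) =
      GrpCat.ofHom (nerveAug N π) ≫ GrpCat.ofHom (nerveAugSection N σ) :=
  GrpCat.hom_ext (MonoidHom.ext fun f => diagrams_inclusion_ext fun j => by
    obtain rfl : j = (0 : Fin 1) := Subsingleton.elim (α := Fin 1) _ _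
    rfl)

include hN in
lemma δ_nerveAug :
    (nerve.obj (inclusion N)).δ (0 : Fin 2) ≫ GrpCat.ofHom (nerveAug N π) =
      (nerve.obj (inclusion N)).δ (1 : Fin 2) ≫ GrpCat.ofHom (nerveAug N π) :=
  GrpCat.hom_ext (MonoidHom.ext fun f => map_objects hN f 1 0)

/-- The contraction of the bicomplex of a normal subgroup with split quotient. -/
def columnContraction :
    (bicomplex.obj (inclusion N)).ColumnContraction (integralChains.obj (GrpCat.of Q)) where
  ε := integralChains.map (GrpCat.ofHom (nerveAug N π))
  s := integralChains.map (GrpCat.ofHom (nerveAugSection N σ))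
  h n := integralChains.map (GrpCat.ofHom (prepend hπ n))
  d_ε := by
    have h : integralChains.map ((nerve.obj (inclusion N)).δ (0 : Fin 2)) ≫
        integralChains.map (GrpCat.ofHom (nerveAug N π)) =
        integralChains.map ((nerve.obj (inclusion N)).δ (1 : Fin 2)) ≫
        integralChains.map (GrpCat.ofHom (nerveAug N π)) :=
      (integralChains.map_comp _ _).symm.trans
        ((congrArg integralChains.map (δ_nerveAug hN)).trans (integralChains.map_comp _ _))
    have hd : (bicomplex.obj (inclusion N)).d 1 0 =
        integralChains.map ((nerve.obj (inclusion N)).δ (0 : Fin 2)) -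
        integralChains.map ((nerve.obj (inclusion N)).δ (1 : Fin 2)) :=
      SimplicialObject.alternatingFaceMapComplex_d_one_zero _
    rw [hd]
    exact (Preadditive.sub_comp _ _ _).trans (sub_eq_zero.2 h)
  comm_zero := SimplicialObject.contraction_d_zero
    (Y := ((SimplicialObject.whiskering _ _).obj integralChains).obj (nerve.obj (inclusion N)))
    (fun n => integralChains.map (GrpCat.ofHom (prepend hπ n)))
    (fun n => (integralChains.map_comp _ _).symm.trans
      ((congrArg integralChains.map (prepend_δ_zero hπ n)).trans (integralChains.map_id _))) _ _
    ((integralChains.map_comp _ _).symm.trans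
      ((congrArg integralChains.map (prepend_δ_one hπ)).trans (integralChains.map_comp _ _)))
  comm_succ := SimplicialObject.contraction_d_succ
    (Y := ((SimplicialObject.whiskering _ _).obj integralChains).obj (nerve.obj (inclusion N)))
    (fun n => integralChains.map (GrpCat.ofHom (prepend hπ n)))
    (fun n => (integralChains.map_comp _ _).symm.trans
      ((congrArg integralChains.map (prepend_δ_zero hπ n)).trans (integralChains.map_id _)))
    (fun n i => (integralChains.map_comp _ _).symm.trans
      ((congrArg integralChains.map (prepend_δ_succ hN hπ n i)).trans
        (integralChains.map_comp _ _)))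

end Inclusion

/-! ### Acyclicity on free crossed modules -/

/-- The projection of `F_S + F_S` to its second factor. -/
def freeProj (S : Type u) : FreeSum S →* FreeGroup S :=
  Monoid.Coprod.lift 1 (MonoidHom.id _)

lemma freeProj_eq_one (S : Type u) (w : FreeSum S) (hw : w ∈ freeKer S) : freeProj S w = 1 := by
  have h : freeKer S ≤ (freeProj S).ker := by
    refine Subgroup.normalClosure_le_normal ?_
    rintro _ ⟨a, rfl⟩
    simp [freeProj]
  exact h hw

/-- Modulo `freeKer S` the first factor dies and `freeProj` is the identity on the second, so the
two homomorphisms agree on both factors. -/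
lemma inr_freeProj_mem (S : Type u) (w : FreeSum S) :
    Monoid.Coprod.inr (freeProj S w) * w⁻¹ ∈ freeKer S := by
  have h : (QuotientGroup.mk' (freeKer S)).comp (Monoid.Coprod.inr.comp (freeProj S)) =
      QuotientGroup.mk' (freeKer S) := by
    refine Monoid.Coprod.hom_ext (MonoidHom.ext fun a => ?_) (MonoidHom.ext fun a => ?_)
    · have ha : (QuotientGroup.mk' (freeKer S)) (Monoid.Coprod.inl a) = 1 :=
        (QuotientGroup.eq_one_iff _).2 (Subgroup.subset_normalClosure ⟨a, rfl⟩)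
      refine Eq.trans ?_ ha.symm
      simp [freeProj]
    · simp [freeProj]
  have hw : (QuotientGroup.mk' (freeKer S)) (Monoid.Coprod.inr (freeProj S w)) =
      (QuotientGroup.mk' (freeKer S)) w := DFunLike.congr_fun h w
  rw [← QuotientGroup.eq_one_iff]
  change QuotientGroup.mk' (freeKer S) (Monoid.Coprod.inr (freeProj S w) * w⁻¹) = 1
  rw [map_mul, hw, ← map_mul, mul_inv_cancel, map_one]

lemma exactAt_totalComplex_free (S : Type u) (n : ℕ) :
    (totalComplex.obj (free S)).ExactAt (n + 2) :=
  (columnContraction (freeProj_eq_one S) (inr_freeProj_mem S)).exactAt_total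
    (Fox.exactAt_inhomogeneousChains _ _ _ n)

lemma exactAt_truncatedComplex_free (S : Type u) (n : ℕ) :
    (truncatedComplex.obj (free S)).ExactAt (n + 1) := by
  rw [HomologicalComplex.exactAt_iff' _ (n + 2) (n + 1) n (by simp) (by simp)]
  exact (HomologicalComplex.exactAt_iff' _ (n + 3) (n + 2) (n + 1) (by simp) (by simp)).1
    (exactAt_totalComplex_free S n)

end XMod

/-! ### Truncation and the shift of homology -/

namespace ChainComplex

open HomologicalComplex

variable {A : Type*} [Category* A] [Abelian A]

/-- Truncation shifts homology, if the differential to the term of degree zero vanishes. -/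
theorem nonempty_homology_truncate_iso (T : ChainComplex A ℕ) (hT : T.d 1 0 = 0) (n : ℕ) :
    Nonempty ((truncate.obj T).homology n ≅ T.homology (n + 1)) := by
  rcases n with _ | n
  -- Both complexes have the same cokernel of `T₂ ⟶ T₁`; it is all of `H₁(T)` because the
  -- differential out of `T₁` is zero.
  · have e : (truncate.obj T).opcycles 0 ≅ T.opcycles 1 :=
      ((truncate.obj T).opcyclesIsCokernel 1 0 (by simp)).coconePointUniqueUpToIso
        (T.opcyclesIsCokernel 2 1 (by simp))
    exact ⟨(truncate.obj T).isoHomologyι₀ ≪≫ e ≪≫ (T.isoHomologyι 1 0 (by simp) hT).symm⟩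
  · exact ⟨(truncate.obj T).homologyIsoSc' (n + 2) (n + 1) n (by simp) (by simp) ≪≫
      (T.homologyIsoSc' (n + 3) (n + 2) (n + 1) (by simp) (by simp)).symm⟩

end ChainComplex

/-! ### The total complex in low degrees -/

namespace XMod

open HomologicalComplex₂

variable {X : XMod.{u}}

/-- A basis element of the bicomplex. -/
def basisElt (p q : ℕ) (x : Fin q → X.diagrams (Fin (p + 1))) : ((bicomplex.obj X).X p).X q :=
  Finsupp.single x (1 : Int'.{u})

lemma bicomplex_hom_ext {p q : ℕ} {M : ModuleCat.{u} Int'.{u}}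
    {f g : ((bicomplex.obj X).X p).X q ⟶ M} (h : ∀ x, f (basisElt p q x) = g (basisElt p q x)) :
    f = g :=
  ModuleCat.hom_ext (Finsupp.lhom_ext' fun x => LinearMap.ext_ring (h x))

/-- The element of the total complex that a basis element of the bicomplex gives. -/
def totalBasisElt (p q n : ℕ) (h : p + q = n) (x : Fin q → X.diagrams (Fin (p + 1))) :
    (totalComplex.obj X).X n :=
  (bicomplex.obj X).ιTotal (ComplexShape.down ℕ) p q n h (basisElt p q x)

lemma totalComplex_hom_ext {n : ℕ} {M : ModuleCat.{u} Int'.{u}}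
    {f g : (totalComplex.obj X).X n ⟶ M}
    (hfg : ∀ p q h x, f (totalBasisElt p q n h x) = g (totalBasisElt p q n h x)) : f = g :=
  total.hom_ext _ fun p q h => bicomplex_hom_ext (hfg p q h)

/-- The face maps of the bicomplex. -/
def face (X : XMod.{u}) (p q : ℕ) (i : Fin (p + 2)) :
    ((bicomplex.obj X).X (p + 1)).X q ⟶ ((bicomplex.obj X).X p).X q :=
  (integralChains.map ((nerve.obj X).δ i)).f q

lemma face_basisElt (p q : ℕ) (i : Fin (p + 2)) (x : Fin q → X.diagrams (Fin (p + 2))) :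
    face X p q i (basisElt (p + 1) q x) =
      basisElt p q fun j => X.restrict (Fin.succAboveOrderEmb i).toOrderHom (x j) :=
  groupHomology.chainsMap_f_single _ _ _ _ _

lemma bicomplex_d_f (p q : ℕ) :
    ((bicomplex.obj X).d (p + 1) p).f q = ∑ i : Fin (p + 2), (-1 : ℤ) ^ (i : ℕ) • face X p q i := by
  have h : (bicomplex.obj X).d (p + 1) p = ∑ i : Fin (p + 2),
      (-1 : ℤ) ^ (i : ℕ) • integralChains.map ((nerve.obj X).δ i) :=
    SimplicialObject.alternatingFaceMapComplex_d _ _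
  exact (congrArg (HomologicalComplex.Hom.f · q) h).trans (map_sum (AddMonoidHom.mk'
    (fun φ : (bicomplex.obj X).X (p + 1) ⟶ (bicomplex.obj X).X p => φ.f q) fun _ _ => rfl) _ _)

lemma bar_d_basisElt (p q : ℕ) (x : Fin (q + 1) → X.diagrams (Fin (p + 1))) :
    ((bicomplex.obj X).X p).d (q + 1) q (basisElt p (q + 1) x) =
      basisElt p q (fun i => x i.succ) + ∑ j : Fin (q + 1),
        (-1 : Int'.{u}) ^ ((j : ℕ) + 1) • basisElt p q (Fin.contractNth j (· * ·) x) :=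
  (ConcreteCategory.congr_hom (groupHomology.inhomogeneousChains.d_def
    (Rep.trivial Int'.{u} (X.diagrams (Fin (p + 1))) Int'.{u}) q) _).trans
    (groupHomology.inhomogeneousChains.d_single
      (A := Rep.trivial Int'.{u} (X.diagrams (Fin (p + 1))) Int'.{u}) q x _)

lemma bar_d_one_zero (p : ℕ) : ((bicomplex.obj X).X p).d 1 0 = 0 := by
  refine bicomplex_hom_ext fun x => (bar_d_basisElt p 0 x).trans ?_
  have : Fin.contractNth (0 : Fin 1) (· * ·) x = (fun i => x i.succ) := Subsingleton.elim _ _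
  simp [this]

/-- On the bar side the coefficients are trivial; on the nerve side the two faces agree on the only
generator of bar degree zero. -/
lemma totalComplex_d_one_zero (X : XMod.{u}) : (totalComplex.obj X).d 1 0 = 0 := by
  refine total.hom_ext _ fun p q h => ?_
  refine Eq.trans ?_ (Limits.comp_zero).symm
  obtain ⟨rfl, rfl⟩ | ⟨rfl, rfl⟩ : (p = 0 ∧ q = 1) ∨ (p = 1 ∧ q = 0) := by
    change p + q = 1 at h
    lia
  · refine ((bicomplex.obj X).ι_total_d_zero_succ 0 1 0 h rfl).trans ?_
    rw [bar_d_one_zero, Limits.zero_comp]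
    rfl
  · refine ((bicomplex.obj X).ι_total_d_succ_zero 0 1 0 h rfl).trans ?_
    have : face X 0 0 0 = face X 0 0 1 := bicomplex_hom_ext fun x =>
      (face_basisElt 0 0 0 x).trans ((congrArg (basisElt 0 0) (Subsingleton.elim _ _)).trans
        (face_basisElt 0 0 1 x).symm)
    rw [bicomplex_d_f, Fin.sum_univ_two]
    simp [this]
    rfl

lemma d_totalBasisElt_zero_two (x : Fin 2 → X.diagrams (Fin 1)) :
    (totalComplex.obj X).d 2 1 (totalBasisElt 0 2 2 rfl x) =
      totalBasisElt 0 1 1 rfl (fun _ => x 1) - totalBasisElt 0 1 1 rfl (fun _ => x 0 * x 1) +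
      totalBasisElt 0 1 1 rfl (fun _ => x 0) := by
  have h0 : (fun i : Fin 1 => x i.succ) = fun _ => x 1 := funext fun i => by fin_cases i; rfl
  have h1 : Fin.contractNth (0 : Fin 2) (· * ·) x = (fun _ => x 0 * x 1) :=
    funext fun i => by fin_cases i; rfl
  have h2 : Fin.contractNth (1 : Fin 2) (· * ·) x = (fun _ => x 0) :=
    funext fun i => by fin_cases i; rfl
  have e : ((bicomplex.obj X).X 0).d 2 1 (basisElt 0 2 x) = basisElt 0 1 (fun _ => x 1) -
      basisElt 0 1 (fun _ => x 0 * x 1) + basisElt 0 1 (fun _ => x 0) := by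
    refine (bar_d_basisElt 0 1 x).trans ?_
    rw [Fin.sum_univ_two, h0, h1, h2]
    simp [sub_eq_add_neg, add_assoc]
  refine (ConcreteCategory.congr_hom
    ((bicomplex.obj X).ι_total_d_zero_succ 1 2 1 rfl rfl) (basisElt 0 2 x)).trans ?_
  refine (congrArg ((bicomplex.obj X).ιTotal (ComplexShape.down ℕ) 0 1 1 rfl) e).trans ?_
  exact (map_add _ _ _).trans (congrArg (· + _) (map_sub _ _ _))

lemma d_totalBasisElt_one_one (x : Fin 1 → X.diagrams (Fin 2)) :
    (totalComplex.obj X).d 2 1 (totalBasisElt 1 1 2 rfl x) =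
      totalBasisElt 0 1 1 rfl
        (fun j => X.restrict (Fin.succAboveOrderEmb (0 : Fin 2)).toOrderHom (x j)) -
      totalBasisElt 0 1 1 rfl
        (fun j => X.restrict (Fin.succAboveOrderEmb (1 : Fin 2)).toOrderHom (x j)) := by
  have hd : ((bicomplex.obj X).d 1 0).f 1 = face X 0 1 0 - face X 0 1 1 := by
    rw [bicomplex_d_f, Fin.sum_univ_two]
    simp [sub_eq_add_neg]
  refine (ConcreteCategory.congr_hom
    ((bicomplex.obj X).ι_total_d_succ_succ 0 0 2 1 rfl rfl) (basisElt 1 1 x)).trans ?_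
  rw [bar_d_one_zero, Limits.zero_comp, smul_zero, add_zero, hd]
  refine (congrArg ((bicomplex.obj X).ιTotal (ComplexShape.down ℕ) 0 1 1 rfl)
    (congrArg₂ (· - ·) (face_basisElt 0 1 0 x) (face_basisElt 0 1 1 x))).trans ?_
  exact map_sub _ _ _

/-- The three faces agree in bar degree zero, and `1 - 1 + 1 = 1`. Hence the generator of bidegree
`(1, 0)` is a boundary. -/
lemma d_totalBasisElt_two_zero (x : Fin 0 → X.diagrams (Fin 3)) (y : Fin 0 → X.diagrams (Fin 2)) :
    (totalComplex.obj X).d 2 1 (totalBasisElt 2 0 2 rfl x) = totalBasisElt 1 0 1 rfl y := by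
  have hf (i : Fin 3) : face X 1 0 i (basisElt 2 0 x) = basisElt 1 0 y :=
    (face_basisElt 1 0 i x).trans (congrArg (basisElt 1 0) (Subsingleton.elim _ _))
  have hd : ((bicomplex.obj X).d 2 1).f 0 = face X 1 0 0 - face X 1 0 1 + face X 1 0 2 := by
    rw [bicomplex_d_f, Fin.sum_univ_three]
    simp [sub_eq_add_neg]
  refine (ConcreteCategory.congr_hom
    ((bicomplex.obj X).ι_total_d_succ_zero 1 2 1 rfl rfl) (basisElt 2 0 x)).trans ?_
  rw [hd]
  refine congrArg ((bicomplex.obj X).ιTotal (ComplexShape.down ℕ) 1 0 1 rfl)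
    (a₂ := basisElt 1 0 y) ?_
  refine (congrArg₂ (· + ·) (congrArg₂ (· - ·) (hf 0) (hf 1)) (hf 2)).trans ?_
  rw [sub_self, zero_add]

/-! ### The coefficient functor as a cokernel -/

/-- The functor `A`, with values in modules over the integers. -/
def coeffModule : XMod.{u} ⥤ ModuleCat.{u} Int'.{u} where
  obj X := ModuleCat.of Int'.{u} (coeff.obj X)
  map φ := ModuleCat.ofHom
    { toFun := coeff.map φ
      map_add' := map_add _
      map_smul' := fun r x => map_zsmul (coeff.map φ).hom r.down x }
  map_id X := ModuleCat.hom_ext (LinearMap.ext fun x =>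
    ConcreteCategory.congr_hom (coeff.map_id X) x)
  map_comp φ ψ := ModuleCat.hom_ext (LinearMap.ext fun x =>
    ConcreteCategory.congr_hom (coeff.map_comp φ ψ) x)

/-- The class of an element of `G` in `A(H, G, μ)`. -/
def coeffClass (g : X.G) : coeffModule.obj X :=
  Additive.ofMul (QuotientGroup.mk' X.coeffKer g)

lemma coeffClass_mul (g g' : X.G) : coeffClass (g * g') = coeffClass g + coeffClass g' := rfl

lemma coeffClass_μ (h : X.H) : coeffClass (X.μ h) = 0 :=
  (QuotientGroup.eq_one_iff _).2 (Subgroup.mem_sup_left ⟨h, rfl⟩)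

lemma map_coeffClass {Y : XMod.{u}} (φ : X ⟶ Y) (g : X.G) :
    coeffModule.map φ (coeffClass g) = coeffClass (φ.ν g) := rfl

/-- The components on the bicomplex of the map from chains of degree one to `A`. -/
def coeffAugComponent (X : XMod.{u}) :
    ∀ p q : ℕ, ((bicomplex.obj X).X p).X q ⟶ coeffModule.obj X
  | 0, 1 => ModuleCat.ofHom (Finsupp.linearCombination (M := coeffModule.obj X) Int'.{u}
      fun x : Fin 1 → X.diagrams (Fin 1) => coeffClass (X.coordG (x 0)))
  | _, _ => 0

/-- The map from chains of degree one to `A`. -/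
def coeffAug (X : XMod.{u}) : (totalComplex.obj X).X 1 ⟶ coeffModule.obj X :=
  totalDesc _ fun p q _ => coeffAugComponent X p q

lemma ι_coeffAug (X : XMod.{u}) (p q : ℕ) (h : p + q = 1) :
    (bicomplex.obj X).ιTotal (ComplexShape.down ℕ) p q 1 h ≫ coeffAug X =
      coeffAugComponent X p q :=
  ι_totalDesc _ _ _ _ h

lemma coeffAug_zero_one (x : Fin 1 → X.diagrams (Fin 1)) :
    coeffAug X (totalBasisElt 0 1 1 rfl x) = coeffClass (X.coordG (x 0)) := by
  refine (ConcreteCategory.congr_hom (ι_coeffAug X 0 1 rfl) (basisElt 0 1 x)).trans ?_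
  exact (Finsupp.linearCombination_single _ _ _).trans (one_smul _ _)

lemma coeffAug_one_zero (x : Fin 0 → X.diagrams (Fin 2)) :
    coeffAug X (totalBasisElt 1 0 1 rfl x) = 0 :=
  ConcreteCategory.congr_hom (ι_coeffAug X 1 0 rfl) (basisElt 1 0 x)

lemma totalComplex_hom_ext_one {M : ModuleCat.{u} Int'.{u}}
    {f g : (totalComplex.obj X).X 1 ⟶ M}
    (h₁ : ∀ x, f (totalBasisElt 0 1 1 rfl x) = g (totalBasisElt 0 1 1 rfl x))
    (h₂ : ∀ x, f (totalBasisElt 1 0 1 rfl x) = g (totalBasisElt 1 0 1 rfl x)) : f = g := by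
  refine totalComplex_hom_ext fun p q h => ?_
  obtain ⟨rfl, rfl⟩ | ⟨rfl, rfl⟩ : (p = 0 ∧ q = 1) ∨ (p = 1 ∧ q = 0) := by lia
  · exact h₁
  · exact h₂

lemma totalComplex_hom_ext_two {M : ModuleCat.{u} Int'.{u}}
    {f g : (totalComplex.obj X).X 2 ⟶ M}
    (h₁ : ∀ x, f (totalBasisElt 0 2 2 rfl x) = g (totalBasisElt 0 2 2 rfl x))
    (h₂ : ∀ x, f (totalBasisElt 1 1 2 rfl x) = g (totalBasisElt 1 1 2 rfl x))
    (h₃ : ∀ x, f (totalBasisElt 2 0 2 rfl x) = g (totalBasisElt 2 0 2 rfl x)) : f = g := by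
  refine totalComplex_hom_ext fun p q h => ?_
  obtain ⟨rfl, rfl⟩ | ⟨rfl, rfl⟩ | ⟨rfl, rfl⟩ :
    (p = 0 ∧ q = 2) ∨ (p = 1 ∧ q = 1) ∨ (p = 2 ∧ q = 0) := by lia
  · exact h₁
  · exact h₂
  · exact h₃

lemma map_totalBasisElt {Y : XMod.{u}} (φ : X ⟶ Y) (p q n : ℕ) (h : p + q = n)
    (x : Fin q → X.diagrams (Fin (p + 1))) :
    (totalComplex.map φ).f n (totalBasisElt p q n h x) =
      totalBasisElt p q n h fun i => mapDiagrams φ (Fin (p + 1)) (x i) := by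
  refine (ConcreteCategory.congr_hom (ιTotal_map (φ := bicomplex.map φ)
    (c₁₂ := ComplexShape.down ℕ) (i₁ := p) (i₂ := q) (i₁₂ := n) (h := h))
    (basisElt p q x)).trans ?_
  refine congrArg ((bicomplex.obj Y).ιTotal (ComplexShape.down ℕ) p q n h) ?_
  exact groupHomology.chainsMap_f_single _ _ _ _ _

lemma coeffAug_naturality {Y : XMod.{u}} (φ : X ⟶ Y) :
    (totalComplex.map φ).f 1 ≫ coeffAug Y = coeffAug X ≫ coeffModule.map φ := by
  refine totalComplex_hom_ext_one (fun x => ?_) fun x => ?_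
  · refine (congrArg (coeffAug Y) (map_totalBasisElt φ 0 1 1 rfl x)).trans ?_
    refine (coeffAug_zero_one _).trans (Eq.trans ?_
      (congrArg (coeffModule.map φ) (coeffAug_zero_one x)).symm)
    exact (map_coeffClass φ _).symm
  · refine (congrArg (coeffAug Y) (map_totalBasisElt φ 1 0 1 rfl x)).trans ?_
    refine (coeffAug_one_zero _).trans (Eq.trans ?_
      (congrArg (coeffModule.map φ) (coeffAug_one_zero x)).symm)
    exact (map_zero (coeffModule.map φ).hom).symm

/-- The two faces are the target and the source of an arrow, which differ by an element of `μ(H)`.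
-/
lemma coeffClass_coordG_restrict_one (f : X.diagrams (Fin 2)) :
    coeffClass (X.coordG (X.restrict (Fin.succAboveOrderEmb (1 : Fin 2)).toOrderHom f)) =
      coeffClass (X.coordG (X.restrict (Fin.succAboveOrderEmb (0 : Fin 2)).toOrderHom f)) := by
  have h1 : X.tgt (f.1 ⟨(0, 1), zero_le_one⟩) = X.src (f.1 ⟨(0, 0), le_rfl⟩) := f.2.2.2.1 0 1 _
  have h2 : X.src (f.1 ⟨(0, 1), zero_le_one⟩) = X.src (f.1 ⟨(1, 1), le_rfl⟩) := f.2.2.1 0 1 _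
  change coeffClass (X.src (f.1 ⟨(0, 0), le_rfl⟩)) = coeffClass (X.src (f.1 ⟨(1, 1), le_rfl⟩))
  rw [← h1, ← h2]
  refine (coeffClass_mul _ _).trans ?_
  rw [coeffClass_μ, zero_add]
  rfl

lemma d_coeffAug (X : XMod.{u}) : (totalComplex.obj X).d 2 1 ≫ coeffAug X = 0 := by
  refine totalComplex_hom_ext_two (fun x => ?_) (fun x => ?_) fun x => ?_
  · refine (congrArg (coeffAug X) (d_totalBasisElt_zero_two x)).trans ?_
    rw [map_add, map_sub, coeffAug_zero_one, coeffAug_zero_one, coeffAug_zero_one]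
    change coeffClass (X.coordG (x 1)) - coeffClass (X.coordG (x 0) * X.coordG (x 1)) +
      coeffClass (X.coordG (x 0)) = 0
    rw [coeffClass_mul]
    abel
  · refine (congrArg (coeffAug X) (d_totalBasisElt_one_one x)).trans ?_
    rw [map_sub, coeffAug_zero_one, coeffAug_zero_one, coeffClass_coordG_restrict_one, sub_self]
    rfl
  · refine (congrArg (coeffAug X) (d_totalBasisElt_two_zero x finZeroElim)).trans ?_
    exact coeffAug_one_zero _

instance (X : XMod.{u}) : Epi (coeffAug X) := by
  rw [ModuleCat.epi_iff_surjective]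
  intro a
  obtain ⟨g, rfl⟩ := QuotientGroup.mk'_surjective X.coeffKer a
  refine ⟨totalBasisElt 0 1 1 rfl fun _ => X.diagramOf (fun _ => 1) g, ?_⟩
  refine (coeffAug_zero_one _).trans ?_
  change coeffClass (X.μ 1 * g) = _
  rw [map_one, one_mul]
  rfl

/-- The diagram of shape a point at an element of `G`. -/
def pointDiagram (X : XMod.{u}) (g : X.G) : X.diagrams (Fin 1) := X.diagramOf (fun _ => 1) g

lemma pointDiagram_mul (g g' : X.G) :
    X.pointDiagram (g * g') = X.pointDiagram g * X.pointDiagram g' := by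
  refine Subtype.ext (funext fun p => ?_)
  change (⟨1 * 1⁻¹, X.μ 1 * (g * g')⟩ : X.H ⋊[X.act] X.G) =
    ⟨1 * 1⁻¹, X.μ 1 * g⟩ * ⟨1 * 1⁻¹, X.μ 1 * g'⟩
  ext <;> simp

lemma pointDiagram_coordG (f : X.diagrams (Fin 1)) : X.pointDiagram (X.coordG f) = f := by
  refine Eq.trans ?_ (X.diagramOf_coord f)
  refine congrArg (X.diagramOf · (X.coordG f)) (funext fun i => ?_)
  obtain rfl : i = 0 := Subsingleton.elim _ _
  exact (congrArg SemidirectProduct.left (f.2.1 0)).symm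

lemma restrict_diagramOf {J K : Type} [Preorder J] [Preorder K] (α : J →o K) (k : K → X.H)
    (g : X.G) : X.restrict α (X.diagramOf k g) = X.diagramOf (fun j => k (α j)) g := rfl

lemma diagramOf_const (h : X.H) : X.diagramOf (fun _ : Fin 1 => h) 1 = X.pointDiagram (X.μ h) := by
  refine Subtype.ext (funext fun p => SemidirectProduct.ext ?_ ?_)
  · change h * h⁻¹ = 1 * 1⁻¹
    simp
  · change X.μ h * 1 = X.μ 1 * X.μ h
    simp

lemma smul_eq_zsmul {R M : Type*} [Ring R] [AddCommGroup M] [Module R M] {r : R} {k : ℤ}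
    (h : r = k) (m : M) : r • m = k • m := by
  rw [h, Int.cast_smul_eq_zsmul]

section Retraction

variable {M : ModuleCat.{u} Int'.{u}} {f : (totalComplex.obj X).X 1 ⟶ M}
  (hf : (totalComplex.obj X).d 2 1 ≫ f = 0)

include hf

lemma map_totalBasisElt_mul (a b : X.diagrams (Fin 1)) :
    f (totalBasisElt 0 1 1 rfl fun _ => a * b) =
      f (totalBasisElt 0 1 1 rfl fun _ => a) + f (totalBasisElt 0 1 1 rfl fun _ => b) := by
  have h : f (totalBasisElt 0 1 1 rfl fun _ => b) - f (totalBasisElt 0 1 1 rfl fun _ => a * b) +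
      f (totalBasisElt 0 1 1 rfl fun _ => a) = 0 := by
    have h := (congrArg f (d_totalBasisElt_zero_two ![a, b])).symm.trans
      (ConcreteCategory.congr_hom hf (totalBasisElt 0 2 2 rfl ![a, b]))
    rw [map_add, map_sub] at h
    exact h
  rw [← sub_eq_zero, ← neg_eq_zero, ← h]
  abel

lemma map_totalBasisElt_one_zero (y : Fin 0 → X.diagrams (Fin 2)) :
    f (totalBasisElt 1 0 1 rfl y) = 0 :=
  (congrArg f (d_totalBasisElt_two_zero finZeroElim y)).symm.trans
    (ConcreteCategory.congr_hom hf (totalBasisElt 2 0 2 rfl finZeroElim))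

/-- The arrow `h` from `1` to `μ(h)` is a chain of bidegree `(1, 1)` whose boundary is `[1] -
[μ(h)]`. -/
lemma map_totalBasisElt_μ (h : X.H) :
    f (totalBasisElt 0 1 1 rfl fun _ => X.pointDiagram (X.μ h)) =
      f (totalBasisElt 0 1 1 rfl fun _ => X.pointDiagram 1) := by
  let x : Fin 1 → X.diagrams (Fin 2) := fun _ => X.diagramOf ![h, 1] 1
  have e := (congrArg f (d_totalBasisElt_one_one x)).symm.trans
    (ConcreteCategory.congr_hom hf (totalBasisElt 1 1 2 rfl x))
  have e0 : X.restrict (Fin.succAboveOrderEmb (0 : Fin 2)).toOrderHom (X.diagramOf ![h, 1] 1) =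
      X.pointDiagram 1 :=
    (restrict_diagramOf _ _ _).trans
      (congrArg (X.diagramOf · 1) (funext fun i : Fin 1 => by fin_cases i; rfl))
  have e1 : X.restrict (Fin.succAboveOrderEmb (1 : Fin 2)).toOrderHom (X.diagramOf ![h, 1] 1) =
      X.pointDiagram (X.μ h) :=
    (restrict_diagramOf _ _ _).trans
      ((congrArg (X.diagramOf · 1) (funext fun i : Fin 1 => by fin_cases i; rfl)).trans
        (diagramOf_const h))
  rw [map_sub] at e
  simp only [x, e0, e1] at e
  exact (sub_eq_zero.1 e).symm

/-- The homomorphism from `G` that a map from chains of degree one gives. -/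
def pointHom : X.G →* Multiplicative M :=
  MonoidHom.mk' (fun g => Multiplicative.ofAdd
    (f (totalBasisElt 0 1 1 rfl fun _ => X.pointDiagram g))) fun g g' => by
    rw [pointDiagram_mul, map_totalBasisElt_mul hf]
    rfl

lemma coeffKer_le_ker_pointHom : X.coeffKer ≤ (pointHom hf).ker := by
  refine sup_le ?_ (Abelianization.commutator_subset_ker _)
  rintro _ ⟨h, rfl⟩
  exact (congrArg Multiplicative.ofAdd (map_totalBasisElt_μ hf h)).trans (map_one (pointHom hf))

/-- The map from `A(H, G, μ)` that a map from chains of degree one gives. -/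
def coeffDesc : coeffModule.obj X ⟶ M :=
  ModuleCat.ofHom (X := coeffModule.obj X)
    { toFun := fun a => (QuotientGroup.lift X.coeffKer (pointHom hf)
        (coeffKer_le_ker_pointHom hf) (Additive.toMul a)).toAdd
      map_add' := fun a b => map_mul (QuotientGroup.lift X.coeffKer (pointHom hf)
        (coeffKer_le_ker_pointHom hf)) (show X.G ⧸ X.coeffKer from a) (show X.G ⧸ X.coeffKer from b)
      map_smul' := fun r a => by
        refine (map_zpow (QuotientGroup.lift X.coeffKer (pointHom hf)
          (coeffKer_le_ker_pointHom hf)) (show X.G ⧸ X.coeffKer from a) r.down).trans ?_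
        exact (smul_eq_zsmul (R := Int'.{u}) (M := M) (ULift.ext r _ (by simp)) _).symm }

lemma coeffDesc_coeffClass (g : X.G) :
    coeffDesc hf (coeffClass g) = f (totalBasisElt 0 1 1 rfl fun _ => X.pointDiagram g) := rfl

lemma coeffAug_coeffDesc : coeffAug X ≫ coeffDesc hf = f := by
  refine totalComplex_hom_ext_one (fun x => ?_) fun x => ?_
  · refine (congrArg (coeffDesc hf) (coeffAug_zero_one x)).trans
      ((coeffDesc_coeffClass hf _).trans ?_)
    rw [pointDiagram_coordG]
    exact congrArg (fun x => f (totalBasisElt 0 1 1 rfl x))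
      (funext fun i => congrArg x (Subsingleton.elim _ _))
  · refine (congrArg (coeffDesc hf) (coeffAug_one_zero x)).trans ?_
    exact (map_zero (coeffDesc hf).hom).trans (map_totalBasisElt_one_zero hf x).symm

end Retraction

open Limits in
/-- `A(H, G, μ)` is the cokernel of the differential `T₂ ⟶ T₁` of the total complex `T`. -/
def coeffAugIsCokernel (X : XMod.{u}) :
    IsColimit (CokernelCofork.ofπ (coeffAug X) (d_coeffAug X)) :=
  CokernelCofork.IsColimit.ofπ _ _ (fun _ hf => coeffDesc hf) (fun _ hf => coeffAug_coeffDesc hf)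
    fun _ hf m hm => by rw [← cancel_epi (coeffAug X), hm, coeffAug_coeffDesc]

open HomologicalComplex in
/-- The module `A(H, G, μ)` as the term in degree zero of the truncated complex, modulo
boundaries. -/
def opcyclesZeroIso (X : XMod.{u}) : (truncatedComplex.obj X).opcycles 0 ≅ coeffModule.obj X :=
  ((truncatedComplex.obj X).opcyclesIsCokernel 1 0 (by simp)).coconePointUniqueUpToIso
    (coeffAugIsCokernel X)

lemma pOpcycles_opcyclesZeroIso_hom (X : XMod.{u}) :
    (truncatedComplex.obj X).pOpcycles 0 ≫ (opcyclesZeroIso X).hom = coeffAug X :=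
  ((truncatedComplex.obj X).opcyclesIsCokernel 1 0 (by simp)).comp_coconePointUniqueUpToIso_hom
    (coeffAugIsCokernel X) Limits.WalkingParallelPair.one

lemma opcyclesZeroIso_hom_naturality {Y : XMod.{u}} (φ : X ⟶ Y) :
    HomologicalComplex.opcyclesMap (truncatedComplex.map φ) 0 ≫ (opcyclesZeroIso Y).hom =
      (opcyclesZeroIso X).hom ≫ coeffModule.map φ := by
  rw [← cancel_epi ((truncatedComplex.obj X).pOpcycles 0), ← Category.assoc, ← Category.assoc,
    HomologicalComplex.p_opcyclesMap, Category.assoc, pOpcycles_opcyclesZeroIso_hom,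
    pOpcycles_opcyclesZeroIso_hom]
  exact coeffAug_naturality φ

/-- The homology in degree zero of the truncated complex. -/
def homologyZeroIso : truncatedComplex.{u} ⋙
    HomologicalComplex.homologyFunctor (ModuleCat.{u} Int'.{u}) (ComplexShape.down ℕ) 0 ≅
      coeffModule :=
  NatIso.ofComponents (fun X => (truncatedComplex.obj X).isoHomologyι₀ ≪≫ opcyclesZeroIso X)
    fun {X Y} φ => by
      change HomologicalComplex.homologyMap (truncatedComplex.map φ) 0 ≫
        (truncatedComplex.obj Y).homologyι 0 ≫ (opcyclesZeroIso Y).hom =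
        ((truncatedComplex.obj X).homologyι 0 ≫ (opcyclesZeroIso X).hom) ≫ coeffModule.map φ
      rw [HomologicalComplex.homologyι_naturality_assoc, opcyclesZeroIso_hom_naturality,
        Category.assoc]

open AlgebraicTopology
/-- The functor `A` in terms of the truncated complex. -/
def coeffIso : (truncatedComplex.{u} ⋙
    HomologicalComplex.homologyFunctor (ModuleCat.{u} Int'.{u}) (ComplexShape.down ℕ) 0) ⋙
      forget₂ (ModuleCat.{u} Int'.{u}) AddCommGrpCat.{u} ≅ coeff.{u} :=
  Functor.isoWhiskerRight homologyZeroIso _ ≪≫ NatIso.ofComponents (fun _ => Iso.refl _)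

/-- The complex that computes the derived functors of `A`. -/
def coeffComplexIso (X : XMod.{u}) :
    ((forget₂ (ModuleCat.{u} Int'.{u}) AddCommGrpCat.{u}).mapHomologicalComplex _).obj
      (ChainComplex.homologyZero (Cotriple.cotripleComplex freeComonad truncatedComplex X)) ≅
      Cotriple.cotripleComplex freeComonad coeff.{u} X := by
  let F := HomologicalComplex.homologyFunctor (ModuleCat.{u} Int'.{u}) (ComplexShape.down ℕ) 0 ⋙
      forget₂ (ModuleCat.{u} Int'.{u}) AddCommGrpCat.{u}
  -- The additive functor `H₀` commutes with alternating sums of faces.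
  have e := Functor.congr_obj (map_alternatingFaceMapComplex F)
    (((SimplicialObject.whiskering _ _).obj truncatedComplex).obj
      ((Cotriple.resolution freeComonad).obj X))
  refine eqToIso e ≪≫ (alternatingFaceMapComplex _).mapIso
    (Functor.isoWhiskerLeft ((Cotriple.resolution freeComonad).obj X) coeffIso)

end XMod

end

theorem theorem2 (X : XMod.{u}) (n : ℕ) :
    Nonempty ((Cotriple.leftDerived XMod.freeComonad.{u} XMod.coeff.{u} n).obj X ≅
      (XMod.homology.{u} (n + 1)).obj X) := by
  obtain ⟨e⟩ := XMod.nonempty_truncatedComplex_homology_iso XMod.exactAt_truncatedComplex_free X n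
  obtain ⟨f⟩ := ChainComplex.nonempty_homology_truncate_iso (XMod.totalComplex.obj X)
    (XMod.totalComplex_d_one_zero X) n
  let D := ChainComplex.homologyZero
    (Cotriple.cotripleComplex XMod.freeComonad XMod.truncatedComplex X)
  -- Passing from modules to abelian groups is exact and so preserves homology.
  have g : (((forget₂ (ModuleCat.{u} XMod.Int'.{u}) AddCommGrpCat.{u}).mapHomologicalComplex
      (ComplexShape.down ℕ)).obj D).homology n ≅ (forget₂ _ _).obj (D.homology n) :=
    ShortComplex.mapHomologyIso (D.sc n) (forget₂ (ModuleCat.{u} XMod.Int'.{u}) AddCommGrpCat.{u})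
  exact ⟨((HomologicalComplex.homologyFunctor _ _ n).mapIso (XMod.coeffComplexIso X)).symm ≪≫ g ≪≫
    (forget₂ _ _).mapIso (e ≪≫ f)⟩
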